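/- For $u\in L^2(\mathbb R)$ (complex-valued) let $(\mathcal F u)(\lambda)=\int_{-\infty}^\infty u(t)e^{-\sqrt{-1}\lambda t}\,dt$ (extended from $L^1\cap L^2$ to $L^2(\mathbb R)$ by continuity). A bivariate process $B_t=(B^1_t,B^2_t)$, $t\in\mathbb R$, is said to have stationary increments if $$E\big[(B^1_{t_1+h}-B^1_{s_1+h})(B^2_{t_2+h}-B^2_{s_2+h})\big]=E\big[(B^1_{t_1}-B^1_{s_1})(B^2_{t_2}-B^2_{s_2})\big]\qquad\text{for all }t_1,t_2,s_1,s_2,h\in\mathbb R .$$ If $B^1$ and $B^2$ are two-sided standard Brownian motions on the same probability space, a measurable function $f:\mathbb R\to\mathbb C$ is called the cross-spectral density of $B$ if for all complex-valued $u,v\in L^2(\mathbb R)$ $$E\left[\left(\int_{-\infty}^\infty u(s)\,dB^1_s\right)\overline{\left(\int_{-\infty}^\infty v(s)\,dB^2_s\right)}\right]=\frac1{2\pi}\int_{-\infty}^\infty(\mathcal Fu)(\lambda)\,\overline{(\mathcal Fv)(\lambda)}\,f(\lambda)\,d\lambda,\tag{1}$$ the integrals on the left being Wiener integrals. Proposition.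 Suppose that a measurable function $f:\mathbb R\to\mathbb C$ satisfies $$\|f\|_\infty\le 1\qquad\text{and}\qquad\overline{f(\lambda)}=f(-\lambda)\ \text{ for almost all }\lambda\in\mathbb R.\tag{2}$$ Then there is a bivariate Gaussian process $B_t=(B^1_t,B^2_t)$ ($t\in\mathbb R$) with stationary increments such that (i) both $B^1$ and $B^2$ are two-sided standard Brownian motions, and (ii) $f$ is the cross-spectral density of $B$, i.e. $f$ satisfies (1) for all $u,v\in L^2(\mathbb R)$. Conversely, if a (not necessarily Gaussian) bivariate process $B_t=(B^1_t,B^2_t)$ ($t\in\mathbb R$) with stationary increments satisfies (i), then there is a measurable function $f:\mathbb R\to\mathbb C$ satisfying (2) and (ii). -/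

import Mathlib

open MeasureTheory ProbabilityTheory
open scoped NNReal ENNReal FourierTransform ComplexConjugate

/-- `B` is a (one-dimensional, standard) two-sided Brownian motion on the time line `ℝ`: the two
processes `(B t)` and `(B (-t))`, `t ≥ 0`, are independent standard Brownian motions. -/
structure IsTwoSidedBrownian {Ω : Type*} [MeasurableSpace Ω] (B : ℝ → Ω → ℝ) (P : Measure Ω) :
    Prop where
  right : IsBrownianReal (fun t : ℝ≥0 => B t) P
  left : IsBrownianReal (fun t : ℝ≥0 => B (-(t : ℝ))) P
  indep : IndepFun (fun ω (t : ℝ≥0) => B t ω) (fun ω (t : ℝ≥0) => B (-(t : ℝ)) ω) P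

/-- The bivariate process `(B¹, B²)` has stationary increments: the cross-moments of the
increments of the two coordinates are invariant under a common shift of time. -/
def HasStationaryIncrements {Ω : Type*} [MeasurableSpace Ω] (B₁ B₂ : ℝ → Ω → ℝ)
    (P : Measure Ω) : Prop :=
  ∀ t₁ t₂ s₁ s₂ h : ℝ,
    ∫ ω, (B₁ (t₁ + h) ω - B₁ (s₁ + h) ω) * (B₂ (t₂ + h) ω - B₂ (s₂ + h) ω) ∂P
      = ∫ ω, (B₁ t₁ ω - B₁ s₁ ω) * (B₂ t₂ ω - B₂ s₂ ω) ∂P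

namespace IsTwoSidedBrownian

variable {Ω : Type*} [MeasurableSpace Ω] {B : ℝ → Ω → ℝ} {P : Measure Ω}

lemma exists_eq_neg_nnreal {t : ℝ} (ht : t ≤ 0) : ∃ s : ℝ≥0, t = -(s : ℝ) :=
  ⟨(-t).toNNReal, by rw [Real.coe_toNNReal _ (by linarith), neg_neg]⟩

lemma hasGaussianLaw (hB : IsTwoSidedBrownian B P) (t : ℝ) : HasGaussianLaw (B t) P := by
  rcases le_total 0 t with h | h
  · lift t to ℝ≥0 using h
    exact hB.right.isGaussianProcess.hasGaussianLaw_eval t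
  · obtain ⟨s, rfl⟩ := exists_eq_neg_nnreal (by assumption : t ≤ 0)
    exact hB.left.isGaussianProcess.hasGaussianLaw_eval s

lemma memLp (hB : IsTwoSidedBrownian B P) (t : ℝ) : MemLp (B t) 2 P :=
  (hB.hasGaussianLaw t).memLp_two

/-- The covariance of two-sided Brownian motion. -/
lemma integral_mul (hB : IsTwoSidedBrownian B P) (s t : ℝ) :
    ∫ ω, B s ω * B t ω ∂P = (|s| + |t| - |s - t|) / 2 := by
  have := hB.right.isGaussianProcess.isProbabilityMeasure
  have hmean : ∀ t, ∫ ω, B t ω ∂P = 0 := by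
    intro t
    rcases le_total 0 t with h | h
    · lift t to ℝ≥0 using h
      exact hB.right.integral_eval t
    · obtain ⟨s, rfl⟩ := exists_eq_neg_nnreal (by assumption : t ≤ 0)
      exact hB.left.integral_eval s
  have hcov : ∀ s t, ∫ ω, B s ω * B t ω ∂P = cov[B s, B t; P] := by
    intro s t
    rw [covariance_eq_sub (hB.memLp s) (hB.memLp t), hmean, zero_mul, sub_zero]
    rfl
  have hpn : ∀ s t : ℝ≥0, cov[B s, B (-(t : ℝ)); P] = 0 := by
    intro s t
    exact (hB.indep.comp (measurable_pi_apply s) (measurable_pi_apply t)).covariance_eq_zero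
      (hB.memLp _) (hB.memLp _)
  rw [hcov]
  rcases le_total 0 s with hs | hs <;> rcases le_total 0 t with ht | ht
  · lift s to ℝ≥0 using hs
    lift t to ℝ≥0 using ht
    rw [hB.right.covariance_eval s t]
    rcases le_total s t with h | h <;> have h' := NNReal.coe_le_coe.2 h
    · rw [min_eq_left h, abs_of_nonpos (sub_nonpos.2 h')]; simp; ring
    · rw [min_eq_right h, abs_of_nonneg (sub_nonneg.2 h')]; simp
  · lift s to ℝ≥0 using hs
    obtain ⟨t, rfl⟩ := exists_eq_neg_nnreal (by assumption : t ≤ 0)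
    rw [hpn, sub_neg_eq_add, abs_of_nonneg (by positivity : 0 ≤ (s : ℝ) + t)]; simp
  · lift t to ℝ≥0 using ht
    obtain ⟨s, rfl⟩ := exists_eq_neg_nnreal (by assumption : s ≤ 0)
    rw [covariance_comm, hpn, abs_sub_comm, sub_neg_eq_add,
      abs_of_nonneg (by positivity : 0 ≤ (t : ℝ) + s)]
    simp; ring
  · obtain ⟨s, rfl⟩ := exists_eq_neg_nnreal (by assumption : s ≤ 0)
    obtain ⟨t, rfl⟩ := exists_eq_neg_nnreal (by assumption : t ≤ 0)
    rw [hB.left.covariance_eval s t, neg_sub_neg, abs_neg, abs_neg]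
    rcases le_total s t with h | h <;> have h' := NNReal.coe_le_coe.2 h
    · rw [min_eq_left h, abs_of_nonneg (sub_nonneg.2 h')]; simp; ring
    · rw [min_eq_right h, abs_of_nonpos (sub_nonpos.2 h')]; simp

end IsTwoSidedBrownian

noncomputable section

/-- The time intervals `(a, b]`, `a ≤ b`. -/
abbrev TimeInterval : Type := {p : ℝ × ℝ // p.1 ≤ p.2}

/-- The step function `∑ c_i 1_{(a_i, b_i]}` as an element of `L²(ℝ)`, for a formal finite linear
combination `∑ c_i (a_i, b_i]` with complex coefficients. -/
def stepFunction : (TimeInterval →₀ ℂ) →ₗ[ℂ] Lp ℂ 2 (volume : Measure ℝ) :=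
  Finsupp.linearCombination ℂ fun p : TimeInterval =>
    indicatorConstLp 2 (measurableSet_Ioc (a := p.1.1) (b := p.1.2)) measure_Ioc_lt_top.ne (1 : ℂ)

/-- The elementary integral `∑ c_i (B_{b_i} - B_{a_i})` in `L²(P)` of the step function
`∑ c_i 1_{(a_i, b_i]}`. -/
def stepIntegral {Ω : Type*} [MeasurableSpace Ω] {B : ℝ → Ω → ℝ} {P : Measure Ω}
    (hB : IsTwoSidedBrownian B P) : (TimeInterval →₀ ℂ) →ₗ[ℂ] Lp ℂ 2 P :=
  Finsupp.linearCombination ℂ fun p : TimeInterval =>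
    (((hB.memLp p.1.2).sub (hB.memLp p.1.1)).ofReal (K := ℂ)).toLp _

/-- The Wiener integral `u ↦ ∫ u(s) dB_s` with respect to a two-sided Brownian motion, for complex
valued `u ∈ L²(ℝ)`: the continuous extension to `L²(ℝ)` of the elementary integral of step
functions. -/
def wienerIntegral {Ω : Type*} [MeasurableSpace Ω] {B : ℝ → Ω → ℝ} {P : Measure Ω}
    (hB : IsTwoSidedBrownian B P) : Lp ℂ 2 (volume : Measure ℝ) →L[ℂ] Lp ℂ 2 P :=
  (stepIntegral hB).extendOfNorm stepFunction

/-- The Fourier transform on `L²(ℝ)` with the normalization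
`(ℱ u)(lam) = ∫ u(t) e^{-i lam t} dt`. -/
def fourierL2 (u : Lp ℂ 2 (volume : Measure ℝ)) (lam : ℝ) : ℂ :=
  (𝓕 u : Lp ℂ 2 (volume : Measure ℝ)) (lam / (2 * Real.pi))

/-- `f` is the cross-spectral density of `(B¹, B²)`:
`E[(∫ u dB¹) conj(∫ v dB²)] = (2π)⁻¹ ∫ (ℱ u)(lam) conj((ℱ v)(lam)) f(lam) dlam` for all complex
valued `u, v ∈ L²(ℝ)`. -/
def IsCrossSpectralDensity {Ω : Type*} [MeasurableSpace Ω] {B₁ B₂ : ℝ → Ω → ℝ} {P : Measure Ω}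
    (h₁ : IsTwoSidedBrownian B₁ P) (h₂ : IsTwoSidedBrownian B₂ P) (f : ℝ → ℂ) : Prop :=
  ∀ u v : Lp ℂ 2 (volume : Measure ℝ),
    ∫ ω, wienerIntegral h₁ u ω * conj (wienerIntegral h₂ v ω) ∂P
      = 1 / (2 * Real.pi) * ∫ lam : ℝ, fourierL2 u lam * conj (fourierL2 v lam) * f lam

end

lemma volume_inter_timeInterval (p q : TimeInterval) :
    volume.real (Set.Ioc p.1.1 p.1.2 ∩ Set.Ioc q.1.1 q.1.2)
    = (|p.1.2 - q.1.1| + |p.1.1 - q.1.2| - |p.1.2 - q.1.2| - |p.1.1 - q.1.1|) / 2 := by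
  obtain ⟨⟨a, b⟩, hab⟩ := p
  obtain ⟨⟨c, d⟩, hcd⟩ := q
  simp only at *
  rw [Set.Ioc_inter_Ioc, Measure.real, Real.volume_Ioc, ENNReal.toReal_ofReal']
  grind

/-- The elementary integral is isometric. -/
lemma inner_stepIntegral {Ω : Type*} [MeasurableSpace Ω] {B : ℝ → Ω → ℝ} {P : Measure Ω}
    (hB : IsTwoSidedBrownian B P) (x y : TimeInterval →₀ ℂ) :
    inner ℂ (stepIntegral hB x) (stepIntegral hB y)
      = inner ℂ (stepFunction x) (stepFunction y) := by
  have key : ∀ p q : TimeInterval,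
      inner ℂ (((((hB.memLp p.1.2).sub (hB.memLp p.1.1)).ofReal (K := ℂ)).toLp _ : Lp ℂ 2 P))
        (((((hB.memLp q.1.2).sub (hB.memLp q.1.1)).ofReal (K := ℂ)).toLp _ : Lp ℂ 2 P))
      = inner ℂ (indicatorConstLp (μ := (volume : Measure ℝ)) 2
          (measurableSet_Ioc (a := p.1.1) (b := p.1.2)) measure_Ioc_lt_top.ne (1 : ℂ))
          (indicatorConstLp (μ := (volume : Measure ℝ)) 2
            (measurableSet_Ioc (a := q.1.1) (b := q.1.2)) measure_Ioc_lt_top.ne (1 : ℂ)) := by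
    intro p q
    rw [L2.inner_indicatorConstLp_one_indicatorConstLp_one _ _ measure_Ioc_lt_top.ne
      measure_Ioc_lt_top.ne, volume_inter_timeInterval, L2.inner_def]
    have h1 := (((hB.memLp p.1.2).sub (hB.memLp p.1.1)).ofReal (K := ℂ)).coeFn_toLp
    have h2 := (((hB.memLp q.1.2).sub (hB.memLp q.1.1)).ofReal (K := ℂ)).coeFn_toLp
    have : ∀ s t, Integrable (fun ω => B s ω * B t ω) P := fun s t =>
      (hB.memLp s).integrable_mul (hB.memLp t)
    calc _ = ∫ ω, (((B p.1.2 ω * B q.1.2 ω - B p.1.2 ω * B q.1.1 ω)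
              - (B p.1.1 ω * B q.1.2 ω - B p.1.1 ω * B q.1.1 ω) : ℝ) : ℂ) ∂P := by
          refine integral_congr_ae ?_
          filter_upwards [h1, h2] with ω e1 e2
          rw [e1, e2]
          simp
          ring
      _ = _ := by
          rw [integral_complex_ofReal, integral_sub, integral_sub, integral_sub]
          · simp only [hB.integral_mul]
            push_cast
            norm_num
            ring
          all_goals first | exact this _ _ | exact (this _ _).sub (this _ _)
  simp only [stepIntegral, stepFunction, Finsupp.linearCombination_apply, Finsupp.sum,
    sum_inner, inner_sum, inner_smul_left, inner_smul_right, key]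

/-- Step functions are dense in `L²(ℝ)`. -/
lemma denseRange_stepFunction : DenseRange stepFunction := by
  rw [DenseRange, ← LinearMap.coe_range, Submodule.dense_iff_topologicalClosure_eq_top,
    Submodule.topologicalClosure_eq_top_iff, Submodule.eq_bot_iff]
  intro g hg
  have hint : ∀ a b : ℝ, a ≤ b → ∫ x in Set.Ioc a b, g x = 0 := by
    intro a b hab
    have := (Submodule.mem_orthogonal _ _).1 hg _
      (LinearMap.mem_range_self stepFunction (Finsupp.single ⟨(a, b), hab⟩ 1))
    simpa only [stepFunction, Finsupp.linearCombination_single, one_smul,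
      L2.inner_indicatorConstLp_one] using this
  have hzero : ∀ a b : ℝ, ∫ x in a..b, g x = 0 := by
    intro a b
    rcases le_total a b with h | h
    · rw [intervalIntegral.integral_of_le h, hint a b h]
    · rw [intervalIntegral.integral_of_ge h, hint b a h, neg_zero]
  have hloc : LocallyIntegrable g volume := (Lp.memLp g).locallyIntegrable (by norm_num)
  refine Lp.ext ?_
  filter_upwards [_root_.LocallyIntegrable.ae_hasDerivAt_integral hloc, Lp.coeFn_zero ℂ 2 (volume : Measure ℝ)] with x hx h0
  rw [h0]
  have h1 := hx 0
  simp only [hzero] at h1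
  exact h1.unique (hasDerivAt_const x 0)

/-- The Wiener integral does extend the elementary integral: `∫ 1_{(a, b]} dB = B_b - B_a`. -/
lemma wienerIntegral_stepFunction {Ω : Type*} [MeasurableSpace Ω] {B : ℝ → Ω → ℝ} {P : Measure Ω}
    (hB : IsTwoSidedBrownian B P) (x : TimeInterval →₀ ℂ) :
    wienerIntegral hB (stepFunction x) = stepIntegral hB x := by
  refine LinearMap.extendOfNorm_eq denseRange_stepFunction ⟨1, fun y => ?_⟩ x
  rw [one_mul, @norm_eq_sqrt_re_inner ℂ, @norm_eq_sqrt_re_inner ℂ _ _ _ _ (stepFunction y),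
    inner_stepIntegral]

/-! Both directions concern one operator: the cross-covariance `C` on `L²(ℝ)` with `⟪v, C u⟫ = E[(∫
u dB¹) conj(∫ v dB²)]`. After the substitution `lam = 2πx`, identity (1) holds as soon as `C` is the
Fourier multiplier with symbol `x ↦ f (2πx)` (`isCrossSpectralDensity_of_crossCovariance_eq`).

Converse. Wiener integrals are isometries, so `C` is a contraction. Stationarity, tested on
intervals, says that the form of `C` is translation invariant, so on the Fourier side `C` commutes
with modulations. Such an operator is multiplication by a function bounded by 1 (`exists_eq_mulL2`):
by `ae_conj_adjoint_mul_eq`, `A g = g · conj (A† w) / conj w`, and a Gaussian `w` vanishes nowhere.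
Since increments are real, `C` commutes with conjugation, which makes the symbol Hermitian.

Existence. Let `e t` be the Fourier transform of the signed indicator of `(0, t]`. In the real
Hilbert space `L² ⊕ L²` the curves `(e, 0)` and `(conj m · e, √(1 - |m|²) · e)` both have squared
increments `|t - s|`, and their cross inner products are real parts of matrix coefficients of the
multiplier with symbol `m`. An isonormal Gaussian process (`exists_isonormal`) and Kolmogorov's
theorem (`exists_continuous_modification`) turn them into Brownian motions (`exists_pair_brownian`).
Translation invariance of the multiplier gives stationarity; Hermitian symmetry makes the
coefficients on intervals real, so nothing is lost in taking real parts. -/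

/-! ### Conjugation and multiplication on `L²` -/

section LpOperators

variable {α : Type*} [MeasurableSpace α]

/-- Complex conjugation on `L²`. -/
noncomputable def conjL2 (μ : Measure α) : Lp ℂ 2 μ →L[ℝ] Lp ℂ 2 μ :=
  (Complex.conjCLE : ℂ →L[ℝ] ℂ).compLpL 2 μ

lemma coeFn_conjL2 {μ : Measure α} (u : Lp ℂ 2 μ) : conjL2 μ u =ᵐ[μ] fun x => conj (u x) := by
  simpa [conjL2] using (Complex.conjCLE : ℂ →L[ℝ] ℂ).coeFn_compLpL u

lemma conjL2_smul {μ : Measure α} (c : ℂ) (u : Lp ℂ 2 μ) :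
    conjL2 μ (c • u) = conj c • conjL2 μ u := by
  refine Lp.ext ?_
  filter_upwards [coeFn_conjL2 (c • u), coeFn_conjL2 u, Lp.coeFn_smul c u,
    Lp.coeFn_smul (conj c) (conjL2 μ u)] with x h1 h2 h3 h4
  rw [h1, h4, h3, Pi.smul_apply, Pi.smul_apply, h2]
  simp

lemma inner_conjL2 {μ : Measure α} (u v : Lp ℂ 2 μ) :
    inner ℂ (conjL2 μ u) (conjL2 μ v) = conj (inner ℂ u v) := by
  rw [L2.inner_def, L2.inner_def, ← integral_conj]
  refine integral_congr_ae ?_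
  filter_upwards [coeFn_conjL2 u, coeFn_conjL2 v] with x h1 h2
  rw [h1, h2]
  simp

/-- Multiplication by an essentially bounded function on `L²`. -/
noncomputable def mulL2 {μ : Measure α} (m : α → ℂ) (hm : MemLp m ∞ μ) :
    Lp ℂ 2 μ →L[ℂ] Lp ℂ 2 μ :=
  (ContinuousLinearMap.mul ℂ ℂ).holderL μ ∞ 2 2 (hm.toLp m)

lemma coeFn_mulL2 {μ : Measure α} {m : α → ℂ} (hm : MemLp m ∞ μ) (u : Lp ℂ 2 μ) :
    mulL2 m hm u =ᵐ[μ] fun x => m x * u x := by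
  filter_upwards [(ContinuousLinearMap.mul ℂ ℂ).coeFn_holder (r := 2) (hm.toLp m) u,
    hm.coeFn_toLp] with x h1 h2
  rw [← h2]
  exact h1

lemma inner_mulL2 {μ : Measure α} {m : α → ℂ} (hm : MemLp m ∞ μ) (u v : Lp ℂ 2 μ) :
    inner ℂ v (mulL2 m hm u) = ∫ x, u x * conj (v x) * m x ∂μ := by
  rw [L2.inner_def]
  refine integral_congr_ae ?_
  filter_upwards [coeFn_mulL2 hm u] with x h
  rw [h, RCLike.inner_apply]
  ring

end LpOperators

/-! ### Translation, reflection and modulation under the Fourier transform -/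

/-- Translation `u ↦ u (· - h)` on `L²(ℝ)`. -/
noncomputable def translateL2 (h : ℝ) :
    Lp ℂ 2 (volume : Measure ℝ) →ₗᵢ[ℂ] Lp ℂ 2 (volume : Measure ℝ) :=
  Lp.compMeasurePreservingₗᵢ ℂ (fun x => x - h) (measurePreserving_sub_right volume h)

lemma coeFn_translateL2 (h : ℝ) (u : Lp ℂ 2 (volume : Measure ℝ)) :
    translateL2 h u =ᵐ[volume] fun x => u (x - h) :=
  Lp.coeFn_compMeasurePreserving u (measurePreserving_sub_right volume h)

/-- Reflection `u ↦ u (- ·)` on `L²(ℝ)`. -/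
noncomputable def reflectL2 :
    Lp ℂ 2 (volume : Measure ℝ) →ₗᵢ[ℂ] Lp ℂ 2 (volume : Measure ℝ) :=
  Lp.compMeasurePreservingₗᵢ ℂ (fun x => -x) (Measure.measurePreserving_neg volume)

lemma coeFn_reflectL2 (u : Lp ℂ 2 (volume : Measure ℝ)) :
    reflectL2 u =ᵐ[volume] fun x => u (-x) :=
  Lp.coeFn_compMeasurePreserving u (Measure.measurePreserving_neg volume)

lemma memLp_top_fourierChar (h : ℝ) :
    MemLp (fun x : ℝ => (Real.fourierChar (-(h * x)) : ℂ)) ∞ volume := by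
  refine memLp_top_of_bound (Continuous.aestronglyMeasurable (by fun_prop)) 1 (.of_forall fun x => ?_)
  exact (Circle.norm_coe _).le

/-- Modulation `u ↦ e^{-2πih·} u` on `L²(ℝ)`. -/
noncomputable def modulateL2 (h : ℝ) :
    Lp ℂ 2 (volume : Measure ℝ) →L[ℂ] Lp ℂ 2 (volume : Measure ℝ) :=
  mulL2 _ (memLp_top_fourierChar h)

lemma coeFn_modulateL2 (h : ℝ) (u : Lp ℂ 2 (volume : Measure ℝ)) :
    modulateL2 h u =ᵐ[volume] fun x => (Real.fourierChar (-(h * x)) : ℂ) * u x :=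
  coeFn_mulL2 _ u

lemma modulateL2_neg_modulateL2 (h : ℝ) (u : Lp ℂ 2 (volume : Measure ℝ)) :
    modulateL2 h (modulateL2 (-h) u) = u := by
  refine Lp.ext ?_
  filter_upwards [coeFn_modulateL2 h (modulateL2 (-h) u), coeFn_modulateL2 (-h) u] with x h1 h2
  rw [h1, h2, ← mul_assoc, ← Circle.coe_mul, ← AddChar.map_add_eq_mul]
  simp

/-- The Fourier transform turns translations into modulations. -/
lemma fourier_translateL2 (h : ℝ) (u : Lp ℂ 2 (volume : Measure ℝ)) :
    𝓕 (translateL2 h u) = modulateL2 h (𝓕 u) := by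
  -- Both sides are continuous in `u`, so Schwartz functions suffice; there the integral formula is
  -- available.
  refine DenseRange.induction_on (p := fun u => 𝓕 (translateL2 h u) = modulateL2 h (𝓕 u))
    (SchwartzMap.denseRange_toLpCLM (E := ℝ) (F := ℂ) (p := 2) ENNReal.ofNat_ne_top) u ?_ ?_
  · refine isClosed_eq ?_ ?_
    · exact (Lp.fourierTransformₗᵢ ℝ ℂ).continuous.comp (translateL2 h).continuous
    · exact (modulateL2 h).continuous.comp (Lp.fourierTransformₗᵢ ℝ ℂ).continuous
  · intro f
    have e1 : translateL2 h (f.toLp 2) = (SchwartzMap.compSubConstCLM ℂ h f).toLp 2 := by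
      refine Lp.ext ?_
      filter_upwards [coeFn_translateL2 h (f.toLp 2), SchwartzMap.coeFn_toLp
        (SchwartzMap.compSubConstCLM ℂ h f) 2 volume,
        (measurePreserving_sub_right volume h).quasiMeasurePreserving.ae
          (SchwartzMap.coeFn_toLp f 2 volume)] with x h1 h2 h3
      rw [h1, h2, h3, SchwartzMap.compSubConstCLM_apply]
    rw [SchwartzMap.toLpCLM_apply, e1, SchwartzMap.toLp_fourier_eq, SchwartzMap.toLp_fourier_eq]
    refine Lp.ext ?_
    filter_upwards [coeFn_modulateL2 h ((𝓕 f : SchwartzMap ℝ ℂ).toLp 2), SchwartzMap.coeFn_toLp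
      (𝓕 f : SchwartzMap ℝ ℂ) 2 volume, SchwartzMap.coeFn_toLp
      (𝓕 (SchwartzMap.compSubConstCLM ℂ h f)) 2 volume] with x h1 h2 h3
    rw [h1, h2, h3, SchwartzMap.fourier_coe, SchwartzMap.fourier_coe, Real.fourier_real_eq,
      Real.fourier_real_eq, ← integral_const_mul,
      ← integral_sub_right_eq_self (fun v => _ * _) h]
    refine integral_congr_ae (.of_forall fun v => ?_)
    simp only [SchwartzMap.compSubConstCLM_apply, Circle.smul_def, smul_eq_mul]
    rw [← mul_assoc, ← Circle.coe_mul, ← AddChar.map_add_eq_mul]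
    congr 4
    ring

/-- The Fourier transform of a complex conjugate. -/
lemma fourier_conjL2 (u : Lp ℂ 2 (volume : Measure ℝ)) :
    𝓕 (conjL2 volume u) = conjL2 volume (reflectL2 (𝓕 u)) := by
  refine DenseRange.induction_on
    (p := fun u => 𝓕 (conjL2 volume u) = conjL2 volume (reflectL2 (𝓕 u)))
    (SchwartzMap.denseRange_toLpCLM (E := ℝ) (F := ℂ) (p := 2) ENNReal.ofNat_ne_top) u ?_ ?_
  · refine isClosed_eq ?_ ?_
    · exact (Lp.fourierTransformₗᵢ ℝ ℂ).continuous.comp (conjL2 volume).continuous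
    · exact (conjL2 volume).continuous.comp
        (reflectL2.continuous.comp (Lp.fourierTransformₗᵢ ℝ ℂ).continuous)
  · intro f
    let g : SchwartzMap ℝ ℂ := f.postcompCLM (𝕜 := ℝ) (Complex.conjCLE : ℂ →L[ℝ] ℂ)
    have e1 : conjL2 volume (f.toLp 2) = g.toLp 2 := by
      refine Lp.ext ?_
      filter_upwards [coeFn_conjL2 (f.toLp 2), SchwartzMap.coeFn_toLp g 2 volume,
          (SchwartzMap.coeFn_toLp f 2 volume)] with x h1 h2 h3
      rw [h1, h2, h3, SchwartzMap.postcompCLM_apply]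
      simp
    rw [SchwartzMap.toLpCLM_apply, e1, SchwartzMap.toLp_fourier_eq, SchwartzMap.toLp_fourier_eq]
    refine Lp.ext ?_
    filter_upwards [coeFn_conjL2 (reflectL2 ((𝓕 f : SchwartzMap ℝ ℂ).toLp 2)),
      coeFn_reflectL2 ((𝓕 f : SchwartzMap ℝ ℂ).toLp 2),
      (Measure.measurePreserving_neg (volume : Measure ℝ)).quasiMeasurePreserving.ae
        (SchwartzMap.coeFn_toLp (𝓕 f : SchwartzMap ℝ ℂ) 2 volume),
      SchwartzMap.coeFn_toLp (𝓕 g) 2 volume] with x h1 h2 h3 h4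
    rw [h1, h2, h3, h4, SchwartzMap.fourier_coe, SchwartzMap.fourier_coe, Real.fourier_real_eq,
      Real.fourier_real_eq, ← integral_conj]
    refine integral_congr_ae (.of_forall fun v => ?_)
    simp only [g, SchwartzMap.postcompCLM_apply, Circle.smul_def, smul_eq_mul, map_mul,
      ← Circle.coe_inv_eq_conj, ← AddChar.map_neg_eq_inv]
    simp

/-- The Fourier transform is injective on `L¹(ℝ)`. -/
lemma MeasureTheory.Integrable.ae_eq_zero_of_fourier_eq_zero {F : ℝ → ℂ} (hF : Integrable F)
    (h : ∀ ξ, 𝓕 F ξ = 0) : ∀ᵐ x, F x = 0 := by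
  refine ae_eq_zero_of_integral_contDiff_smul_eq_zero hF.locallyIntegrable fun g hg hc => ?_
  have hg' : ContDiff ℝ ((⊤ : ℕ∞) : WithTop ℕ∞) (fun x => (g x : ℂ)) := Complex.ofRealCLM.contDiff.comp hg
  have hc' : HasCompactSupport (fun x => (g x : ℂ)) := hc.comp_left (g := ((↑) : ℝ → ℂ)) rfl
  let φ : SchwartzMap ℝ ℂ := hc'.toSchwartzMap hg'
  obtain ⟨ψ, hψ⟩ : ∃ ψ : SchwartzMap ℝ ℂ, 𝓕 ψ = φ := ⟨𝓕⁻ φ, FourierTransform.fourier_fourierInv_eq φ⟩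
  -- Every test function is the transform of a Schwartz function `ψ`, and `∫ 𝓕F · ψ = ∫ F · 𝓕ψ`
  -- moves the transform off `F`.
  have key := VectorFourier.integral_fourierIntegral_smul_eq_flip (μ := volume) (ν := volume)
    (L := innerₗ ℝ) (f := F) (g := ψ) Real.continuous_fourierChar (by fun_prop) hF ψ.integrable
  have e2 : ∀ x, VectorFourier.fourierIntegral Real.fourierChar volume (innerₗ ℝ).flip ψ x = φ x := by
    intro x
    rw [← hψ, flip_innerₗ, SchwartzMap.fourier_coe]
    rfl
  have e1 : ∀ x, VectorFourier.fourierIntegral Real.fourierChar volume (innerₗ ℝ) F x = 0 := h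
  simp only [e1, e2, zero_smul, integral_zero] at key
  rw [key]
  refine integral_congr_ae (.of_forall fun x => ?_)
  simp [φ, mul_comm]

/-! ### Gaussian subspaces of `L²` and isonormal processes -/

section GaussianL2

variable {Ω : Type*} [MeasurableSpace Ω] {P : Measure Ω}

/-- Subtracting 1 makes the function vanish at 0, as needed for composition with it to act on `L²`.
-/
lemma lipschitzWith_cexp_mul_I_sub_one (t : ℝ) :
    LipschitzWith ‖t‖₊ (fun x : ℝ => Complex.exp (t * x * Complex.I) - 1) := by
  refine LipschitzWith.of_dist_le_mul fun x y => ?_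
  have h : Complex.exp (t * x * Complex.I)
      = Complex.exp (t * y * Complex.I) * Complex.exp (Complex.I * (t * (x - y) : ℝ)) := by
    rw [← Complex.exp_add]; congr 1; push_cast; ring
  rw [dist_eq_norm, sub_sub_sub_cancel_right, h, ← mul_sub_one, norm_mul, dist_eq_norm,
    show (t * y * Complex.I : ℂ) = ((t * y : ℝ) : ℂ) * Complex.I by push_cast; ring,
    Complex.norm_exp_ofReal_mul_I, one_mul, coe_nnnorm, ← norm_mul]
  exact Real.norm_exp_I_mul_ofReal_sub_one_le

/-- On a probability space the expectation is the inner product with the constant 1. -/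
lemma continuous_integral_L2 {𝕜 : Type*} [RCLike 𝕜] [IsProbabilityMeasure P] :
    Continuous fun X : Lp 𝕜 2 P => ∫ ω, X ω ∂P := by
  have : (fun X : Lp 𝕜 2 P => ∫ ω, X ω ∂P) = fun X : Lp 𝕜 2 P =>
      inner 𝕜 (indicatorConstLp 2 MeasurableSet.univ (measure_ne_top P _) (1 : 𝕜)) X := by
    ext X
    rw [L2.inner_indicatorConstLp_one, setIntegral_univ]
  rw [this]
  fun_prop

/-- Composition with a Lipschitz function fixing 0 is continuous on `L²`, and so is the expectation.
Characteristic functions thus turn Gaussianity into a closed condition. -/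
lemma continuous_charFun_map_L2 [IsProbabilityMeasure P] (t : ℝ) :
    Continuous fun X : Lp ℝ 2 P => charFun (P.map X) t := by
  have h0 : (fun x : ℝ => Complex.exp (t * x * Complex.I) - 1) 0 = 0 := by simp
  have : (fun X : Lp ℝ 2 P => charFun (P.map X) t) = fun X : Lp ℝ 2 P =>
      ∫ ω, (lipschitzWith_cexp_mul_I_sub_one t).compLp h0 X ω ∂P + 1 := by
    ext X
    have hX : AEMeasurable X P := (Lp.aestronglyMeasurable X).aemeasurable
    have hm : AEStronglyMeasurable (fun ω => Complex.exp (t * X ω * Complex.I)) P := by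
      have : Continuous fun x : ℝ => Complex.exp (t * x * Complex.I) := by fun_prop
      exact this.comp_aestronglyMeasurable (Lp.aestronglyMeasurable X)
    rw [charFun_apply_real, integral_map hX (Continuous.aestronglyMeasurable (by fun_prop)),
      integral_congr_ae ((lipschitzWith_cexp_mul_I_sub_one t).coeFn_compLp h0 X)]
    simp only [Function.comp_apply]
    rw [integral_sub _ (integrable_const _)]
    · simp
    · refine Integrable.of_bound hm 1 (.of_forall fun ω => ?_)
      rw [show (t * X ω * Complex.I : ℂ) = ((t * X ω : ℝ) : ℂ) * Complex.I by push_cast; ring,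
        Complex.norm_exp_ofReal_mul_I]
  rw [this]
  exact (continuous_integral_L2.comp
    ((lipschitzWith_cexp_mul_I_sub_one t).continuous_compLp h0)).add continuous_const

/-- Centered Gaussian variables form a closed subset of `L²`. -/
lemma isClosed_setOf_hasLaw_gaussianReal [IsProbabilityMeasure P] :
    IsClosed {X : Lp ℝ 2 P | HasLaw X (gaussianReal 0 (‖X‖₊ ^ 2)) P} := by
  have : {X : Lp ℝ 2 P | HasLaw X (gaussianReal 0 (‖X‖₊ ^ 2)) P}
      = ⋂ t : ℝ, {X : Lp ℝ 2 P | charFun (P.map X) t = Complex.exp (-(‖X‖ ^ 2 * t ^ 2 / 2))} := by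
    ext X
    have hX : AEMeasurable X P := (Lp.aestronglyMeasurable X).aemeasurable
    have := Measure.isProbabilityMeasure_map hX
    simp only [Set.mem_iInter, Set.mem_ofPred_eq]
    constructor
    · intro h t
      rw [h.map_eq, charFun_gaussianReal]
      simp
    · refine fun h => ⟨hX, Measure.ext_of_charFun (funext fun t => ?_)⟩
      rw [h, charFun_gaussianReal]
      simp
  rw [this]
  refine isClosed_iInter fun t => isClosed_eq (continuous_charFun_map_L2 t) ?_
  fun_prop

lemma ProbabilityTheory.HasGaussianLaw.hasLaw_of_integral_eq_zero {X : Lp ℝ 2 P}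
    (hX : HasGaussianLaw X P) (h0 : ∫ ω, X ω ∂P = 0) :
    HasLaw X (gaussianReal 0 (‖X‖₊ ^ 2)) P := by
  have := hX.isProbabilityMeasure
  refine ⟨hX.aemeasurable, ?_⟩
  rw [hX.map_eq_gaussianReal, h0]
  congr
  rw [variance_of_integral_eq_zero hX.aemeasurable h0]
  have : ∫ ω, (X ω) ^ 2 ∂P = ‖X‖ ^ 2 := by
    rw [← real_inner_self_eq_norm_sq, L2.inner_def]
    refine integral_congr_ae (.of_forall fun ω => ?_)
    simp [sq]
  rw [this, Real.toNNReal_pow (norm_nonneg _), norm_toNNReal]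

/-- Every real Hilbert space carries an isonormal Gaussian process. -/
theorem exists_isonormal (K : Type) [NormedAddCommGroup K] [InnerProductSpace ℝ K]
    [CompleteSpace K] :
    ∃ (Ω : Type) (_ : MeasurableSpace Ω) (P : Measure Ω) (_ : IsProbabilityMeasure P)
      (Z : K →ₗᵢ[ℝ] Lp ℝ 2 P), ∀ h, HasLaw (Z h) (gaussianReal 0 (‖h‖₊ ^ 2)) P := by
  -- Independent standard normals indexed by a Hilbert basis are orthonormal in `L²(P)`; `Z` sends
  -- the basis to them.
  obtain ⟨ι, b, -⟩ := exists_hilbertBasis ℝ K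
  let P : Measure (ι → ℝ) := Measure.infinitePi fun _ => gaussianReal 0 1
  have hlaw : ∀ i, HasLaw (fun ω : ι → ℝ => ω i) (gaussianReal 0 1) P := fun i =>
    (measurePreserving_eval_infinitePi (fun _ => gaussianReal 0 1) i).hasLaw
  have hind : iIndepFun (fun (i : ι) (ω : ι → ℝ) => ω i) P :=
    iIndepFun_infinitePi (P := fun _ : ι => gaussianReal 0 1) (X := fun _ x => x) (by fun_prop)
  have hmem : ∀ i, MemLp (fun ω : ι → ℝ => ω i) 2 P := fun i => (hlaw i).hasGaussianLaw.memLp_two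
  have hmean : ∀ i, ∫ ω, ω i ∂P = 0 := fun i => by
    rw [(hlaw i).integral_eq, integral_id_gaussianReal]
  let ξ : ι → Lp ℝ 2 P := fun i => (hmem i).toLp
  have hinner : ∀ i j, inner ℝ (ξ i) (ξ j) = cov[fun ω => ω i, fun ω => ω j; P] := by
    intro i j
    rw [covariance_eq_sub (hmem i) (hmem j), hmean, zero_mul, sub_zero, L2.inner_def]
    refine integral_congr_ae ?_
    filter_upwards [(hmem i).coeFn_toLp, (hmem j).coeFn_toLp] with ω h1 h2
    rw [h1, h2, Pi.mul_apply]
    simp [mul_comm]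
  have hξ : Orthonormal ℝ ξ := by
    classical
    rw [orthonormal_iff_ite]
    intro i j
    rw [hinner]
    split_ifs with h
    · subst h
      rw [covariance_self (hlaw i).aemeasurable, (hlaw i).variance_eq, variance_id_gaussianReal]
      simp
    · exact (hind.indepFun h).covariance_eq_zero (hmem i) (hmem j)
  let Z : K →ₗᵢ[ℝ] Lp ℝ 2 P :=
    hξ.orthogonalFamily.linearIsometry.comp b.repr.toLinearIsometry
  refine ⟨ι → ℝ, inferInstance, P, inferInstance, Z, fun h => ?_⟩
  have hsum := hξ.orthogonalFamily.hasSum_linearIsometry (b.repr h)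
  have : Z h ∈ {X : Lp ℝ 2 P | HasLaw X (gaussianReal 0 (‖X‖₊ ^ 2)) P} := by
    -- The partial sums of the basis expansion are finite combinations of independent normals, and
    -- the limit stays in the closed set.
    refine isClosed_setOf_hasLaw_gaussianReal.mem_of_tendsto hsum (.of_forall fun s => ?_)
    have hae : (∑ i ∈ s, (LinearIsometry.toSpanSingleton ℝ (Lp ℝ 2 P) (hξ.1 i)) (b.repr h i) :
        Lp ℝ 2 P) =ᵐ[P] fun ω => ∑ i : s, b.repr h i * ω i := by
      have h1 : ∀ i : s, ((LinearIsometry.toSpanSingleton ℝ (Lp ℝ 2 P) (hξ.1 i)) (b.repr h i) :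
        Lp ℝ 2 P) =ᵐ[P] fun ω => b.repr h i * ω i := by
        intro i
        rw [LinearIsometry.toSpanSingleton_apply]
        filter_upwards [Lp.coeFn_smul (b.repr h i) (ξ i), (hmem i).coeFn_toLp] with ω h1 h2
        rw [h1, Pi.smul_apply, h2, smul_eq_mul]
      rw [← Finset.sum_coe_sort]
      filter_upwards [Lp.coeFn_fun_finsetSum Finset.univ fun i : s =>
        ((LinearIsometry.toSpanSingleton ℝ (Lp ℝ 2 P) (hξ.1 i)) (b.repr h i)),
        ae_all_iff.2 h1] with ω h2 h3
      rw [h2]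
      exact Finset.sum_congr rfl fun i _ => h3 i
    have hg : HasGaussianLaw (fun ω : ι → ℝ => ∑ i : s, b.repr h i * ω i) P := by
      refine iIndepFun.hasGaussianLaw_fun_sum (X := fun (i : s) (ω : ι → ℝ) => b.repr h i * ω i)
        (fun i => (hlaw i).hasGaussianLaw.fun_smul _) ?_
      have hs : iIndepFun (fun (i : s) (ω : ι → ℝ) => ω i) P :=
        hind.precomp (g := ((↑) : s → ι)) Subtype.val_injective
      exact hs.comp (fun i x => b.repr h i * x) fun i => measurable_const_mul _
    refine HasGaussianLaw.hasLaw_of_integral_eq_zero (hg.congr hae.symm) ?_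
    rw [integral_congr_ae hae, integral_finsetSum]
    · simp [integral_const_mul, hmean]
    · exact fun i _ => ((hlaw i).hasGaussianLaw.integrable).const_mul _
  have hn : ‖Z h‖₊ = ‖h‖₊ := Z.nnnorm_map h
  rwa [Set.mem_ofPred_eq, hn] at this

/-- The values of an isonormal process along a family of vectors form a Gaussian process. -/
lemma isGaussianProcess_of_isonormal {K : Type*} [NormedAddCommGroup K] [InnerProductSpace ℝ K]
    (Z : K →ₗᵢ[ℝ] Lp ℝ 2 P) (hZ : ∀ h, HasLaw (Z h) (gaussianReal 0 (‖h‖₊ ^ 2)) P)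
    {T : Type*} (φ : T → K) : IsGaussianProcess (fun t => (Z (φ t) : Ω → ℝ)) P where
  hasGaussianLaw I := by
    classical
    have hm : AEMeasurable (fun ω => I.restrict fun t => Z (φ t) ω) P :=
      aemeasurable_pi_lambda _ fun i => (hZ (φ i)).aemeasurable
    refine ⟨isGaussian_of_map_eq_gaussianReal fun L => ?_⟩
    -- With `c i` the coefficients of `L`, linearity of `Z` makes `L` of the random vector a.e.
    -- equal to `Z (∑ c i • φ i)`, a single Gaussian.
    let c : I → ℝ := fun i => L fun j => if i = j then 1 else 0
    refine ⟨0, ‖∑ i : I, c i • φ i‖₊ ^ 2, ?_⟩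
    rw [AEMeasurable.map_map_of_aemeasurable (by fun_prop) hm,
      ← (hZ (∑ i : I, c i • φ i)).map_eq]
    refine Measure.map_congr ?_
    rw [map_sum]
    have h1 : ∀ i : I, (Z (c i • φ i) : Ω → ℝ) =ᵐ[P] fun ω => c i * Z (φ i) ω := by
      intro i
      rw [map_smul]
      filter_upwards [Lp.coeFn_smul (c i) (Z (φ i))] with ω h
      rw [h, Pi.smul_apply, smul_eq_mul]
    filter_upwards [Lp.coeFn_fun_finsetSum Finset.univ fun i : I => Z (c i • φ i),
      ae_all_iff.2 h1] with ω h2 h3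
    rw [h2, Function.comp_apply, ← ContinuousLinearMap.coe_coe, LinearMap.pi_apply_eq_sum_univ]
    refine Finset.sum_congr rfl fun i _ => ?_
    rw [h3, smul_eq_mul, mul_comm]
    rfl

end GaussianL2

/-! ### Kolmogorov's continuity theorem by dyadic approximation -/

section Continuity

open Filter Topology

/-- The largest dyadic number of level `n` below `t`. -/
noncomputable def dyadicFloor (n : ℕ) (t : ℝ) : ℝ := ⌊2 ^ n * t⌋ / 2 ^ n

lemma sq_sub_dyadicFloor_le (n : ℕ) (t : ℝ) : (t - dyadicFloor n t) ^ 2 ≤ (1 / 4) ^ n := by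
  have h2 : (0 : ℝ) < 2 ^ n := by positivity
  have h : t - dyadicFloor n t = Int.fract (2 ^ n * t) / 2 ^ n := by
    rw [dyadicFloor, Int.fract]; field_simp
  rw [h, div_pow, one_div, inv_pow, ← pow_mul, mul_comm n 2, pow_mul, div_eq_mul_inv]
  norm_num
  rw [abs_of_nonneg (Int.fract_nonneg _)]
  exact (Int.fract_lt_one _).le

lemma floor_mul_mem_Ico {N : ℕ} {t : ℝ} (ht : |t| < N) (n : ℕ) :
    ⌊2 ^ n * t⌋ ∈ Finset.Ico (-(N * 2 ^ n : ℤ)) (N * 2 ^ n) := by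
  obtain ⟨h1, h2⟩ := abs_lt.1 ht
  have : (0 : ℝ) < 2 ^ n := by positivity
  rw [Finset.mem_Ico, Int.le_floor, Int.floor_lt]
  push_cast
  constructor <;> nlinarith

/-- A bound on the increments of `x` along the dyadic grids. -/
def DyadicIncrementBound (ρ : ℝ) (x : ℝ → ℝ) : Prop :=
  ∀ N : ℕ, ∃ K : ℝ, ∀ n : ℕ, ∀ k ∈ Finset.Ico (-(N * 2 ^ n : ℤ)) (N * 2 ^ n),
    |x ((k + 1) / 2 ^ n) - x (k / 2 ^ n)| ≤ K * ρ ^ n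

/-- Refining the grid either keeps the floor or moves it one step to the right on the finer grid. -/
lemma exists_abs_dyadicFloor_succ_sub_le {ρ : ℝ} (hρ : 0 ≤ ρ) {x : ℝ → ℝ}
    (hx : DyadicIncrementBound ρ x) (N : ℕ) :
    ∃ K, ∀ (n : ℕ) (t : ℝ), |t| < N →
      dist (x (dyadicFloor n t)) (x (dyadicFloor (n + 1) t)) ≤ K * ρ ^ n := by
  obtain ⟨K, hK⟩ := hx N
  -- The extra `ρ` comes from the step being taken at level `n + 1`; `|K|` keeps the bound
  -- nonnegative when the floor does not move.
  refine ⟨|K| * ρ, fun n t ht => ?_⟩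
  have h2 : (2 : ℝ) ^ n ≠ 0 := by positivity
  have e : dyadicFloor n t = ((2 * ⌊2 ^ n * t⌋ : ℤ) : ℝ) / 2 ^ (n + 1) := by
    rw [dyadicFloor, pow_succ]; push_cast; field_simp
  have hnn : 0 ≤ |K| * ρ * ρ ^ n := by positivity
  have hle : 2 * ⌊2 ^ n * t⌋ ≤ ⌊2 ^ (n + 1) * t⌋ := by
    rw [Int.le_floor]; push_cast; rw [pow_succ]
    nlinarith [Int.floor_le (2 ^ n * t)]
  have hlt : ⌊2 ^ (n + 1) * t⌋ < 2 * ⌊2 ^ n * t⌋ + 2 := by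
    rw [Int.floor_lt]; push_cast; rw [pow_succ]
    nlinarith [Int.lt_floor_add_one (2 ^ n * t)]
  obtain h | h : ⌊2 ^ (n + 1) * t⌋ = 2 * ⌊2 ^ n * t⌋ ∨ ⌊2 ^ (n + 1) * t⌋ = 2 * ⌊2 ^ n * t⌋ + 1 := by
    omega
  · rw [e, dyadicFloor, h, dist_self]
    exact hnn
  · have hmem : 2 * ⌊2 ^ n * t⌋ ∈ Finset.Ico (-(N * 2 ^ (n + 1) : ℤ)) (N * 2 ^ (n + 1)) := by
      have := Finset.mem_Ico.1 (floor_mul_mem_Ico ht n)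
      rw [Finset.mem_Ico, pow_succ]
      constructor <;> linarith
    have := hK (n + 1) _ hmem
    rw [e, dyadicFloor, h, dist_comm, Real.dist_eq]
    push_cast at this ⊢
    refine this.trans ?_
    rw [pow_succ, mul_assoc, mul_comm ρ]
    gcongr
    exact le_abs_self K

/-- Points closer than one grid step have equal or adjacent floors. -/
lemma exists_abs_dyadicFloor_sub_le {ρ : ℝ} (hρ : 0 ≤ ρ) {x : ℝ → ℝ}
    (hx : DyadicIncrementBound ρ x) (N : ℕ) :
    ∃ K, ∀ (n : ℕ) (s t : ℝ), |s| < N → |t| < N → |s - t| < 1 / 2 ^ n →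
      dist (x (dyadicFloor n s)) (x (dyadicFloor n t)) ≤ K * ρ ^ n := by
  obtain ⟨K, hK⟩ := hx N
  refine ⟨|K|, fun n s t hs ht hst => ?_⟩
  wlog h : s ≤ t generalizing s t
  · rw [dist_comm]
    exact this t s ht hs (by rwa [abs_sub_comm]) (le_of_not_ge h)
  have h2 : (0 : ℝ) < 2 ^ n := by positivity
  rw [abs_sub_comm, abs_of_nonneg (by linarith), lt_div_iff₀ h2] at hst
  have hle : ⌊2 ^ n * s⌋ ≤ ⌊2 ^ n * t⌋ := Int.floor_mono (by nlinarith)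
  have hlt : ⌊2 ^ n * t⌋ < ⌊2 ^ n * s⌋ + 2 := by
    rw [Int.floor_lt]; push_cast
    nlinarith [Int.lt_floor_add_one (2 ^ n * s)]
  obtain h | h : ⌊2 ^ n * t⌋ = ⌊2 ^ n * s⌋ ∨ ⌊2 ^ n * t⌋ = ⌊2 ^ n * s⌋ + 1 := by omega
  · rw [dyadicFloor, dyadicFloor, h, dist_self]
    positivity
  · have := hK n _ (floor_mul_mem_Ico hs n)
    rw [dyadicFloor, dyadicFloor, h, dist_comm, Real.dist_eq]
    push_cast at this ⊢
    refine this.trans ?_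
    gcongr
    exact le_abs_self K

/-- A function with geometrically decaying dyadic increments extends continuously from the dyadic
numbers to the real line. -/
lemma exists_continuous_tendsto_dyadicFloor {ρ : ℝ} (hρ : 0 ≤ ρ) (hρ1 : ρ < 1) {x : ℝ → ℝ}
    (hx : DyadicIncrementBound ρ x) :
    ∃ y : ℝ → ℝ, Continuous y ∧ ∀ t, Tendsto (fun n => x (dyadicFloor n t)) atTop (𝓝 (y t)) := by
  have hlim : ∀ t, ∃ y, Tendsto (fun n => x (dyadicFloor n t)) atTop (𝓝 y) := by
    intro t
    obtain ⟨N, hN⟩ := exists_nat_gt |t|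
    obtain ⟨K, hK⟩ := exists_abs_dyadicFloor_succ_sub_le hρ hx N
    exact cauchySeq_tendsto_of_complete
      (cauchySeq_of_le_geometric ρ K hρ1 fun n => hK n t hN)
  choose y hy using hlim
  refine ⟨y, continuous_iff_continuousAt.2 fun t => ?_, hy⟩
  -- The margin 1 keeps all `s` with `|s - t| < 1` in the range where the bounds hold.
  obtain ⟨N, hN⟩ := exists_nat_gt (|t| + 1)
  obtain ⟨K, hK⟩ := exists_abs_dyadicFloor_succ_sub_le hρ hx N
  obtain ⟨K', hK'⟩ := exists_abs_dyadicFloor_sub_le hρ hx N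
  have hd : ∀ (n : ℕ) (s : ℝ), |s| < N → dist (x (dyadicFloor n s)) (y s) ≤ K * ρ ^ n / (1 - ρ) := fun n s hs =>
    dist_le_of_le_geometric_of_tendsto ρ K hρ1 (fun n => hK n s hs) (hy s) n
  -- Two geometric tails, at `s` and at `t`, plus one comparison at level `n`.
  have hto : Tendsto (fun n : ℕ => (2 * (K / (1 - ρ)) + K') * ρ ^ n) atTop (𝓝 0) := by
    simpa using (tendsto_pow_atTop_nhds_zero_of_lt_one hρ hρ1).const_mul (2 * (K / (1 - ρ)) + K')
  rw [Metric.continuousAt_iff]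
  intro ε hε
  obtain ⟨n, hn⟩ := (hto.eventually_lt_const hε).exists
  refine ⟨min 1 (1 / 2 ^ n), by positivity, fun s hs => ?_⟩
  rw [Real.dist_eq, lt_min_iff] at hs
  have hs' : |s| < N := by
    have := abs_sub_abs_le_abs_sub s t
    linarith
  have ht' : |t| < N := by linarith
  calc dist (y s) (y t) ≤ dist (y s) (x (dyadicFloor n s))
        + dist (x (dyadicFloor n s)) (x (dyadicFloor n t)) + dist (x (dyadicFloor n t)) (y t) :=
        dist_triangle4 _ _ _ _
    _ ≤ K * ρ ^ n / (1 - ρ) + K' * ρ ^ n + K * ρ ^ n / (1 - ρ) := by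
        rw [dist_comm (y s)]
        gcongr
        · exact hd n s hs'
        · exact hK' n s t hs' ht' hs.2
        · exact hd n t ht'
    _ = (2 * (K / (1 - ρ)) + K') * ρ ^ n := by ring
    _ < ε := hn

variable {Ω : Type*} [MeasurableSpace Ω] {P : Measure Ω}

lemma ae_tsum_lt_top {f : ℕ → Ω → ℝ≥0∞} (hf : ∀ n, AEMeasurable (f n) P) {a : ℕ → ℝ}
    (ha : Summable a) (h : ∀ n, ∫⁻ ω, f n ω ∂P ≤ ENNReal.ofReal (a n)) :
    ∀ᵐ ω ∂P, ∑' n, f n ω < ∞ := by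
  refine ae_lt_top' (AEMeasurable.tsum hf) ?_
  rw [lintegral_tsum hf]
  exact ne_top_of_le_ne_top ha.tsum_ofReal_ne_top (ENNReal.tsum_le_tsum h)

/-- Level `n` has `2N·2^n` increments, each with fourth moment at most `C·4^(-n)`. Weighted by
`r^n`, the sums have expectations at most `2NC(r/2)^n`, which are summable because `r = (10/9)^4 <
2`. Almost surely the total is finite, and it bounds each weighted increment. -/
lemma ae_dyadicIncrementBound {X : ℝ → Ω → ℝ} (hX : ∀ t, AEMeasurable (X t) P) {C : ℝ}
    (h : ∀ s t, ∫⁻ ω, ENNReal.ofReal ((X t ω - X s ω) ^ 4) ∂P ≤ ENNReal.ofReal (C * (t - s) ^ 2)) :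
    ∀ᵐ ω ∂P, DyadicIncrementBound (9 / 10) fun t => X t ω := by
  refine ae_all_iff.2 fun N => ?_
  let r : ℝ := (10 / 9) ^ 4
  let I : ℕ → Finset ℤ := fun n => Finset.Ico (-(N * 2 ^ n : ℤ)) (N * 2 ^ n)
  let f : ℕ → Ω → ℝ≥0∞ := fun n ω =>
    ∑ k ∈ I n, ENNReal.ofReal (r ^ n) * ENNReal.ofReal ((X ((k + 1) / 2 ^ n) ω - X (k / 2 ^ n) ω) ^ 4)
  have hm : ∀ n (k : ℤ), AEMeasurable
      (fun ω => ENNReal.ofReal ((X ((k + 1) / 2 ^ n) ω - X (k / 2 ^ n) ω) ^ 4)) P := fun n k =>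
    (((hX _).sub (hX _)).pow_const 4).ennreal_ofReal
  have hr : ∀ n, 0 ≤ r ^ n := fun n => by positivity
  have key : ∀ᵐ ω ∂P, ∑' n, f n ω < ∞ := by
    have hs : Summable fun n : ℕ => 2 * N * C * (r / 2) ^ n := by
      refine (summable_geometric_of_lt_one (by positivity) ?_).mul_left _
      norm_num [r]
    refine ae_tsum_lt_top (fun n => ?_) hs fun n => ?_
    · exact Finset.aemeasurable_fun_sum _ fun k _ => (hm n k).const_mul _
    · rw [lintegral_finsetSum' _ fun k _ => (hm n k).const_mul _]
      calc _ ≤ ∑ k ∈ I n, ENNReal.ofReal (r ^ n * (C * (1 / 4) ^ n)) := by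
            refine Finset.sum_le_sum fun k _ => ?_
            rw [lintegral_const_mul'' _ (hm n k), ENNReal.ofReal_mul (hr n)]
            gcongr
            refine (h _ _).trans (le_of_eq ?_)
            congr 2
            rw [← sub_div, add_sub_cancel_left, div_pow, div_pow, ← pow_mul, mul_comm n 2, pow_mul]
            norm_num
        _ = ENNReal.ofReal (2 * N * C * (r / 2) ^ n) := by
            have : (I n).card = 2 * N * 2 ^ n := by
              rw [Int.card_Ico]
              have : (N * 2 ^ n - -(N * 2 ^ n) : ℤ) = ((2 * N * 2 ^ n : ℕ) : ℤ) := by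
                push_cast; ring
              rw [this, Int.toNat_natCast]
            rw [Finset.sum_const, this, ← ENNReal.ofReal_nsmul]
            congr 1
            rw [nsmul_eq_mul, div_pow, div_pow, one_pow, show (4 : ℝ) = 2 * 2 by norm_num, mul_pow]
            push_cast
            field_simp
  filter_upwards [key] with ω hω
  -- The maximum with 1 gives `S ≤ M ≤ M^4`, avoiding a fourth root of the total `S`.
  refine ⟨max 1 (∑' n, f n ω).toReal, fun n k hk => ?_⟩
  have h1 : r ^ n * (X ((k + 1) / 2 ^ n) ω - X (k / 2 ^ n) ω) ^ 4 ≤ (∑' n, f n ω).toReal := by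
    rw [← ENNReal.ofReal_le_iff_le_toReal hω.ne, ENNReal.ofReal_mul (hr n)]
    exact (Finset.single_le_sum (f := fun k : ℤ => ENNReal.ofReal (r ^ n) *
      ENNReal.ofReal ((X ((k + 1) / 2 ^ n) ω - X (k / 2 ^ n) ω) ^ 4)) (fun _ _ => zero_le) hk).trans
      (ENNReal.le_tsum n)
  have h2 : (1 : ℝ) ≤ max 1 (∑' n, f n ω).toReal := le_max_left _ _
  have h3 := le_max_right (1 : ℝ) (∑' n, f n ω).toReal
  set M := max 1 (∑' n, f n ω).toReal
  rw [← pow_le_pow_iff_left₀ (abs_nonneg _) (by positivity) (by norm_num : 4 ≠ 0),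
    Even.pow_abs (by decide)]
  have h4 : r ^ n * ((9 / 10 : ℝ) ^ n) ^ 4 = 1 := by
    simp only [r]
    rw [← pow_mul, ← pow_mul, mul_comm n 4, ← mul_pow]
    norm_num
  calc _ = (r ^ n * (X ((k + 1) / 2 ^ n) ω - X (k / 2 ^ n) ω) ^ 4) * ((9 / 10 : ℝ) ^ n) ^ 4 := by
        rw [mul_right_comm, h4, one_mul]
    _ ≤ M ^ 4 * ((9 / 10 : ℝ) ^ n) ^ 4 := by
        gcongr
        exact (h1.trans h3).trans (le_self_pow₀ h2 (by norm_num))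
    _ = _ := (mul_pow _ _ _).symm

/-- At a fixed time the fourth moments of the approximation errors are summable, so the errors tend
to 0 almost surely. -/
lemma ae_tendsto_dyadicFloor {X : ℝ → Ω → ℝ} (hX : ∀ t, AEMeasurable (X t) P) {C : ℝ}
    (hC : 0 ≤ C)
    (h : ∀ s t, ∫⁻ ω, ENNReal.ofReal ((X t ω - X s ω) ^ 4) ∂P ≤ ENNReal.ofReal (C * (t - s) ^ 2))
    (t : ℝ) : ∀ᵐ ω ∂P, Tendsto (fun n => X (dyadicFloor n t) ω) atTop (𝓝 (X t ω)) := by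
  have hs : Summable fun n : ℕ => C * (1 / 4 : ℝ) ^ n :=
    (summable_geometric_of_lt_one (by norm_num) (by norm_num)).mul_left _
  have key := ae_tsum_lt_top (P := P)
    (f := fun n ω => ENNReal.ofReal ((X t ω - X (dyadicFloor n t) ω) ^ 4))
    (fun n => (((hX _).sub (hX _)).pow_const 4).ennreal_ofReal) hs fun n => by
      refine (h _ _).trans (ENNReal.ofReal_le_ofReal ?_)
      gcongr
      exact sq_sub_dyadicFloor_le n t
  filter_upwards [key] with ω hω
  have h0 := ENNReal.tendsto_atTop_zero_of_tsum_ne_top hω.ne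
  have h1 : Tendsto (fun n => (X t ω - X (dyadicFloor n t) ω) ^ 4) atTop (𝓝 0) := by
    have := (ENNReal.tendsto_toReal ENNReal.zero_ne_top).comp h0
    refine this.congr fun n => ?_
    exact ENNReal.toReal_ofReal (Even.pow_nonneg (by decide) _)
  have h2 : Tendsto (fun n => √√((X t ω - X (dyadicFloor n t) ω) ^ 4)) atTop (𝓝 0) := by
    simpa using (h1.sqrt).sqrt
  have h3 : Tendsto (fun n => |X t ω - X (dyadicFloor n t) ω|) atTop (𝓝 0) := by
    refine h2.congr fun n => ?_
    rw [show (X t ω - X (dyadicFloor n t) ω) ^ 4 = ((X t ω - X (dyadicFloor n t) ω) ^ 2) ^ 2 by ring,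
      Real.sqrt_sq (sq_nonneg _), Real.sqrt_sq_eq_abs]
  rw [tendsto_iff_dist_tendsto_zero]
  refine h3.congr fun n => ?_
  rw [dist_comm, Real.dist_eq]

/-- **Kolmogorov's continuity theorem** on the real line, for fourth moments. -/
theorem exists_continuous_modification {X : ℝ → Ω → ℝ} (hX : ∀ t, AEMeasurable (X t) P) {C : ℝ}
    (hC : 0 ≤ C)
    (h : ∀ s t, ∫⁻ ω, ENNReal.ofReal ((X t ω - X s ω) ^ 4) ∂P ≤ ENNReal.ofReal (C * (t - s) ^ 2)) :
    ∃ Y : ℝ → Ω → ℝ, (∀ t, X t =ᵐ[P] Y t) ∧ ∀ᵐ ω ∂P, Continuous fun t => Y t ω := by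
  -- The limit exists simultaneously for all `t` off one null set; elsewhere `limUnder` may take an
  -- arbitrary value.
  refine ⟨fun t ω => limUnder atTop fun n => X (dyadicFloor n t) ω, fun t => ?_, ?_⟩
  · filter_upwards [ae_tendsto_dyadicFloor hX hC h t] with ω hω
    exact hω.limUnder_eq.symm
  · filter_upwards [ae_dyadicIncrementBound hX h] with ω hω
    obtain ⟨y, hy, hlim⟩ := exists_continuous_tendsto_dyadicFloor (by norm_num) (by norm_num) hω
    simpa only [(hlim _).limUnder_eq] using hy

end Continuity

/-! ### From curves in a Hilbert space to Brownian motions -/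

section BrownianConstruction

variable {Ω : Type*} [MeasurableSpace Ω] {P : Measure Ω}

/-- A centered continuous Gaussian process with the covariance of two-sided Brownian motion is a
two-sided Brownian motion. -/
lemma isTwoSidedBrownian_of_integral_mul {X : ℝ → Ω → ℝ} (hX : IsGaussianProcess X P)
    (h0 : ∀ t, ∫ ω, X t ω ∂P = 0)
    (hc : ∀ s t, ∫ ω, X s ω * X t ω ∂P = (|s| + |t| - |s - t|) / 2)
    (hcont : ∀ᵐ ω ∂P, Continuous fun t => X t ω) : IsTwoSidedBrownian X P := by
  have := hX.isProbabilityMeasure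
  have hmem : ∀ t, MemLp (X t) 2 P := fun t => (hX.hasGaussianLaw_eval t).memLp_two
  have hcov : ∀ s t, cov[X s, X t; P] = (|s| + |t| - |s - t|) / 2 := by
    intro s t
    rw [covariance_eq_sub (hmem s) (hmem t), h0, zero_mul, sub_zero, ← hc]
    rfl
  refine ⟨⟨?_, ?_⟩, ⟨?_, ?_⟩, ?_⟩
  · refine (hX.comp_right ((↑) : ℝ≥0 → ℝ)).isPreBrownianReal_of_covariance (fun t => h0 t)
      fun s t hst => ?_
    have hst' := NNReal.coe_le_coe.2 hst
    refine (hcov s t).trans ?_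
    rw [abs_of_nonpos (sub_nonpos.2 hst')]
    simp
    ring
  · filter_upwards [hcont] with ω hω
    fun_prop
  · refine (hX.comp_right (fun t : ℝ≥0 => -(t : ℝ))).isPreBrownianReal_of_covariance
      (fun t => h0 _) fun s t hst => ?_
    have hst' := NNReal.coe_le_coe.2 hst
    refine (hcov _ _).trans ?_
    rw [neg_sub_neg, abs_of_nonneg (sub_nonneg.2 hst')]
    simp
    ring
  · filter_upwards [hcont] with ω hω
    fun_prop
  -- Jointly Gaussian families are independent once uncorrelated, and `|s| + |t| - |s - t|` vanishes
  -- for times of opposite sign.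
  · refine IsGaussianProcess.indepFun_of_covariance_eq_zero (X := fun (t : ℝ≥0) => X t)
      (Y := fun (t : ℝ≥0) => X (-(t : ℝ))) ?_ (fun t => hX.aemeasurable _)
      (fun t => hX.aemeasurable _) fun s t => ?_
    · convert! hX.comp_right (Sum.elim (fun t : ℝ≥0 => (t : ℝ)) (fun t : ℝ≥0 => -(t : ℝ))) using 1
      ext (s | s) <;> rfl
    · rw [hcov, sub_neg_eq_add, abs_of_nonneg (by positivity : 0 ≤ (s : ℝ) + t)]
      simp

lemma lintegral_pow_four_of_hasLaw_gaussianReal {X : Ω → ℝ} {v : ℝ≥0}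
    (hX : HasLaw X (gaussianReal 0 (v ^ 2)) P) :
    ∫⁻ ω, ENNReal.ofReal (X ω ^ 4) ∂P
      = ENNReal.ofReal ((∫ x, x ^ 4 ∂gaussianReal 0 1) * ((v : ℝ) ^ 2) ^ 2) := by
  have hm : Measurable fun x : ℝ => ENNReal.ofReal (x ^ 4) := by fun_prop
  have hv : gaussianReal 0 (v ^ 2) = (gaussianReal 0 1).map ((v : ℝ) * ·) := by
    rw [gaussianReal_map_const_mul, mul_zero]
    congr
    ext
    simp
  have hint : Integrable (fun x : ℝ => x ^ 4) (gaussianReal 0 1) := by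
    have := (memLp_id_gaussianReal (μ := 0) (v := 1) 4).integrable_norm_pow (p := 4) (by norm_num)
    simpa [Even.pow_abs (by decide : Even 4)] using this
  rw [← lintegral_map' (f := fun x => ENNReal.ofReal (x ^ 4)) hm.aemeasurable hX.aemeasurable,
    hX.map_eq, hv, lintegral_map hm (measurable_const_mul _),
    ← ofReal_integral_eq_lintegral_ofReal, mul_comm, ← integral_const_mul]
  · congr 2
    ext x
    ring
  · simp_rw [mul_pow]
    exact hint.const_mul _
  · exact .of_forall fun x => Even.pow_nonneg (by decide) _

/-- Two curves in a Hilbert space with Brownian increments give rise to a pair of jointly Gaussian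
Brownian motions. -/
theorem exists_pair_brownian {K : Type} [NormedAddCommGroup K] [InnerProductSpace ℝ K]
    [CompleteSpace K] (φ : Fin 2 → ℝ → K) (h0 : ∀ i, φ i 0 = 0)
    (hφ : ∀ i s t, ‖φ i t - φ i s‖ ^ 2 = |t - s|) :
    ∃ (Ω : Type) (_ : MeasurableSpace Ω) (P : Measure Ω) (_ : IsProbabilityMeasure P)
      (B : Fin 2 → ℝ → Ω → ℝ), IsGaussianProcess (fun t ω => (B 0 t ω, B 1 t ω)) P ∧
        (∀ i, IsTwoSidedBrownian (B i) P) ∧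
        ∀ i j s t, ∫ ω, B i s ω * B j t ω ∂P = inner ℝ (φ i s) (φ j t) := by
  obtain ⟨Ω, _, P, _, Z, hZ⟩ := exists_isonormal K
  have hmod : ∀ i, ∃ Y : ℝ → Ω → ℝ, (∀ t, Z (φ i t) =ᵐ[P] Y t) ∧
      ∀ᵐ ω ∂P, Continuous fun t => Y t ω := by
    intro i
    -- The fourth moment of an increment is that of a standard normal times `‖φ i t - φ i s‖ ^ 4 =
    -- (t - s) ^ 2`.
    refine exists_continuous_modification (C := ∫ x, x ^ 4 ∂gaussianReal 0 1)
      (fun t => (hZ _).aemeasurable) (integral_nonneg fun x => Even.pow_nonneg (by decide) _)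
      fun s t => ?_
    have hsub : HasLaw (fun ω => Z (φ i t) ω - Z (φ i s) ω)
        (gaussianReal 0 (‖φ i t - φ i s‖₊ ^ 2)) P := by
      refine (hZ (φ i t - φ i s)).congr ?_
      rw [map_sub]
      exact (Lp.coeFn_sub _ _).symm
    rw [lintegral_pow_four_of_hasLaw_gaussianReal hsub, coe_nnnorm, hφ, sq_abs]
  choose B hB hcont using hmod
  have hG : IsGaussianProcess (fun p : Fin 2 × ℝ => B p.1 p.2) P :=
    (isGaussianProcess_of_isonormal Z hZ fun p : Fin 2 × ℝ => φ p.1 p.2).congr fun p => hB _ _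
  have hprod : ∀ i j s t, ∫ ω, B i s ω * B j t ω ∂P = inner ℝ (φ i s) (φ j t) := by
    intro i j s t
    rw [← Z.inner_map_map, L2.inner_def]
    refine integral_congr_ae ?_
    filter_upwards [hB i s, hB j t] with ω h1 h2
    rw [← h1, ← h2]
    simp [mul_comm]
  refine ⟨Ω, _, P, inferInstance, B, ?_, fun i => ?_, hprod⟩
  · refine hG.of_isGaussianProcess fun t => ⟨{(0, t), (1, t)},
      (ContinuousLinearMap.proj ⟨(0, t), by simp⟩).prod (ContinuousLinearMap.proj ⟨(1, t), by simp⟩),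
      fun ω => rfl⟩
  · refine isTwoSidedBrownian_of_integral_mul (hG.comp_right fun t => (i, t)) (fun t => ?_)
      (fun s t => ?_) (hcont i)
    · rw [← integral_congr_ae (hB i t), (hZ _).integral_eq, integral_id_gaussianReal]
    · have hn : ∀ t, ‖φ i t‖ ^ 2 = |t| := fun t => by simpa [h0] using hφ i 0 t
      rw [hprod, real_inner_eq_norm_mul_self_add_norm_mul_self_sub_norm_sub_mul_self_div_two,
        ← sq, ← sq, ← sq, hn, hn, hφ]

end BrownianConstruction

/-! ### Fourier multipliers and their symmetries -/

section Multiplier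

/-- The Fourier multiplier on `L²(ℝ)` with symbol `m`. -/
noncomputable def multiplierL2 (m : ℝ → ℂ) (hm : MemLp m ∞ volume) :
    Lp ℂ 2 (volume : Measure ℝ) →L[ℂ] Lp ℂ 2 (volume : Measure ℝ) :=
  ((Lp.fourierTransformₗᵢ ℝ ℂ).symm : Lp ℂ 2 (volume : Measure ℝ) →L[ℂ] _) ∘L mulL2 m hm ∘L
    ((Lp.fourierTransformₗᵢ ℝ ℂ) : Lp ℂ 2 (volume : Measure ℝ) →L[ℂ] _)

variable {m : ℝ → ℂ} (hm : MemLp m ∞ volume)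

lemma fourier_multiplierL2 (u : Lp ℂ 2 (volume : Measure ℝ)) :
    𝓕 (multiplierL2 m hm u) = mulL2 m hm (𝓕 u) :=
  (Lp.fourierTransformₗᵢ ℝ ℂ).apply_symm_apply _

lemma inner_multiplierL2 (u v : Lp ℂ 2 (volume : Measure ℝ)) :
    inner ℂ v (multiplierL2 m hm u) = inner ℂ (𝓕 v) (mulL2 m hm (𝓕 u)) := by
  rw [← Lp.inner_fourier_eq, fourier_multiplierL2]

lemma inner_modulateL2 (h : ℝ) (u v : Lp ℂ 2 (volume : Measure ℝ)) :
    inner ℂ (modulateL2 h v) (modulateL2 h u) = inner ℂ v u := by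
  rw [L2.inner_def, L2.inner_def]
  refine integral_congr_ae ?_
  filter_upwards [coeFn_modulateL2 h u, coeFn_modulateL2 h v] with x h1 h2
  rw [h1, h2, RCLike.inner_apply, RCLike.inner_apply, map_mul, mul_mul_mul_comm,
    RCLike.mul_conj, Circle.norm_coe]
  simp

lemma mulL2_modulateL2 (h : ℝ) (u : Lp ℂ 2 (volume : Measure ℝ)) :
    mulL2 m hm (modulateL2 h u) = modulateL2 h (mulL2 m hm u) := by
  refine Lp.ext ?_
  filter_upwards [coeFn_modulateL2 h u, coeFn_modulateL2 h (mulL2 m hm u), coeFn_mulL2 hm u,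
    coeFn_mulL2 hm (modulateL2 h u)] with x h1 h2 h3 h4
  rw [h4, h1, h2, h3]
  ring

/-- Translations become modulations, which are unitary and commute with multiplication by the
symbol. This yields stationary increments. -/
lemma inner_translateL2_multiplierL2 (h : ℝ) (u v : Lp ℂ 2 (volume : Measure ℝ)) :
    inner ℂ (translateL2 h v) (multiplierL2 m hm (translateL2 h u))
      = inner ℂ v (multiplierL2 m hm u) := by
  rw [inner_multiplierL2, inner_multiplierL2, fourier_translateL2, fourier_translateL2,
    mulL2_modulateL2, inner_modulateL2]

/-- On the Fourier side conjugation becomes conjugation composed with reflection, which commutes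
with multiplication by a Hermitian symbol. -/
lemma inner_conjL2_multiplierL2 (hsymm : ∀ᵐ x, conj (m x) = m (-x))
    (u v : Lp ℂ 2 (volume : Measure ℝ)) :
    inner ℂ (conjL2 volume v) (multiplierL2 m hm (conjL2 volume u))
      = conj (inner ℂ v (multiplierL2 m hm u)) := by
  have key : mulL2 m hm (conjL2 volume (reflectL2 (𝓕 u)))
      = conjL2 volume (reflectL2 (mulL2 m hm (𝓕 u))) := by
    refine Lp.ext ?_
    filter_upwards [coeFn_mulL2 hm (conjL2 volume (reflectL2 (𝓕 u))),
      coeFn_conjL2 (reflectL2 (𝓕 u)), coeFn_conjL2 (reflectL2 (mulL2 m hm (𝓕 u))),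
      coeFn_reflectL2 (𝓕 u), coeFn_reflectL2 (mulL2 m hm (𝓕 u)),
      (Measure.measurePreserving_neg (volume : Measure ℝ)).quasiMeasurePreserving.ae
        (coeFn_mulL2 hm (𝓕 u)), hsymm] with x h1 h2 h3 h4 h5 h6 h7
    rw [h1, h2, h3, h4, h5, h6, map_mul, ← h7, Complex.conj_conj]
  rw [inner_multiplierL2, inner_multiplierL2, fourier_conjL2, fourier_conjL2, key, inner_conjL2,
    reflectL2.inner_map_map]

end Multiplier

/-! ### Indicators of intervals in `L²(ℝ)` -/

section Interval

/-- The indicator of a time interval, as an element of `L²(ℝ)`. -/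
noncomputable def intervalL2 (p : TimeInterval) : Lp ℂ 2 (volume : Measure ℝ) :=
  indicatorConstLp 2 (measurableSet_Ioc (a := p.1.1) (b := p.1.2)) measure_Ioc_lt_top.ne (1 : ℂ)

lemma stepFunction_single (p : TimeInterval) : stepFunction (Finsupp.single p 1) = intervalL2 p := by
  simp [stepFunction, intervalL2]

lemma dense_span_range_intervalL2 :
    Dense (Submodule.span ℂ (Set.range intervalL2) : Set (Lp ℂ 2 (volume : Measure ℝ))) := by
  have := denseRange_stepFunction
  rw [DenseRange, ← LinearMap.coe_range, stepFunction, Finsupp.range_linearCombination] at this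
  exact this

lemma conjL2_intervalL2 (p : TimeInterval) : conjL2 volume (intervalL2 p) = intervalL2 p := by
  refine Lp.ext ?_
  filter_upwards [coeFn_conjL2 (intervalL2 p), indicatorConstLp_coeFn (p := 2)
    (hs := measurableSet_Ioc (a := p.1.1) (b := p.1.2)) (hμs := measure_Ioc_lt_top.ne)
    (c := (1 : ℂ)) (μ := volume)] with x h1 h2
  rw [h1, intervalL2, h2, Set.indicator_apply]
  split_ifs <;> simp

/-- The time interval `p` shifted by `h`. -/
def TimeInterval.shift (h : ℝ) (p : TimeInterval) : TimeInterval :=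
  ⟨(p.1.1 + h, p.1.2 + h), by simpa using p.2⟩

lemma translateL2_intervalL2 (h : ℝ) (p : TimeInterval) :
    translateL2 h (intervalL2 p) = intervalL2 (p.shift h) := by
  refine Lp.ext ?_
  filter_upwards [coeFn_translateL2 h (intervalL2 p),
    (measurePreserving_sub_right volume h).quasiMeasurePreserving.ae (indicatorConstLp_coeFn (p := 2)
    (hs := measurableSet_Ioc (a := p.1.1) (b := p.1.2)) (hμs := measure_Ioc_lt_top.ne)
    (c := (1 : ℂ)) (μ := volume)), indicatorConstLp_coeFn (p := 2)
    (hs := measurableSet_Ioc (a := (p.shift h).1.1) (b := (p.shift h).1.2))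
    (hμs := measure_Ioc_lt_top.ne) (c := (1 : ℂ)) (μ := volume)] with x h1 h2 h3
  rw [h1, intervalL2, h2, intervalL2, h3]
  simp [Set.indicator_apply, TimeInterval.shift, lt_sub_iff_add_lt]

/-- Operators on `L²(ℝ)` are determined by their matrix coefficients on time intervals. -/
lemma eq_of_inner_intervalL2 {A A' : Lp ℂ 2 (volume : Measure ℝ) →L[ℂ] Lp ℂ 2 (volume : Measure ℝ)}
    (h : ∀ p q, inner ℂ (intervalL2 q) (A (intervalL2 p)) = inner ℂ (intervalL2 q) (A' (intervalL2 p))) :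
    A = A' := by
  refine ContinuousLinearMap.ext_on dense_span_range_intervalL2 ?_
  rintro _ ⟨p, rfl⟩
  have : innerSL ℂ (A (intervalL2 p)) = innerSL ℂ (A' (intervalL2 p)) := by
    refine ContinuousLinearMap.ext_on dense_span_range_intervalL2 ?_
    rintro _ ⟨q, rfl⟩
    rw [innerSL_apply_apply, innerSL_apply_apply, ← inner_conj_symm, h, inner_conj_symm]
  exact (innerSL_inj).1 this

/-- The curve `t ↦ 1_{(0, t]}` (signed for negative `t`) in `L²(ℝ)`. -/
noncomputable def signedIntervalL2 (t : ℝ) : Lp ℂ 2 (volume : Measure ℝ) :=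
  if h : 0 ≤ t then intervalL2 ⟨(0, t), h⟩ else -intervalL2 ⟨(t, 0), (not_le.1 h).le⟩

lemma intervalL2_add {a b c : ℝ} (hab : a ≤ b) (hbc : b ≤ c) :
    intervalL2 ⟨(a, b), hab⟩ + intervalL2 ⟨(b, c), hbc⟩ = intervalL2 ⟨(a, c), hab.trans hbc⟩ := by
  rw [intervalL2, intervalL2, ← indicatorConstLp_disjoint_union]
  · simp only [Set.Ioc_union_Ioc_eq_Ioc hab hbc, intervalL2]
  · exact Set.Ioc_disjoint_Ioc_of_le le_rfl

lemma signedIntervalL2_sub (p : TimeInterval) :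
    signedIntervalL2 p.1.2 - signedIntervalL2 p.1.1 = intervalL2 p := by
  obtain ⟨⟨a, b⟩, hab⟩ := p
  simp only at hab ⊢
  rw [signedIntervalL2, signedIntervalL2]
  split_ifs with h1 h2 h2
  · rw [← intervalL2_add h2 hab]; abel
  · rw [← intervalL2_add (not_le.1 h2).le h1]; abel
  · linarith
  · rw [← intervalL2_add hab (not_le.1 h1).le]; abel

lemma signedIntervalL2_zero : signedIntervalL2 0 = 0 := by
  simp [signedIntervalL2, intervalL2]

lemma norm_signedIntervalL2_sub_sq (s t : ℝ) :
    ‖signedIntervalL2 t - signedIntervalL2 s‖ ^ 2 = |t - s| := by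
  wlog h : s ≤ t generalizing s t
  · rw [norm_sub_rev, this t s (le_of_not_ge h), abs_sub_comm]
  rw [signedIntervalL2_sub ⟨(s, t), h⟩, intervalL2, norm_indicatorConstLp (by simp) (by simp),
    abs_of_nonneg (sub_nonneg.2 h)]
  simp only [norm_one, one_mul, ENNReal.toReal_ofNat, Real.volume_real_Ioc_of_le h]
  rw [← Real.sqrt_eq_rpow, Real.sq_sqrt (sub_nonneg.2 h)]

end Interval

/-! ### Wiener integrals and the cross-covariance operator -/

section Wiener

variable {Ω : Type*} [MeasurableSpace Ω] {B₁ B₂ : ℝ → Ω → ℝ} {P : Measure Ω}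

lemma norm_wienerIntegral {B : ℝ → Ω → ℝ} (hB : IsTwoSidedBrownian B P) (u : Lp ℂ 2 (volume : Measure ℝ)) :
    ‖wienerIntegral hB u‖ = ‖u‖ := by
  refine denseRange_stepFunction.induction_on (p := fun u => ‖wienerIntegral hB u‖ = ‖u‖) u
    (isClosed_eq (by fun_prop) (by fun_prop)) fun x => ?_
  rw [wienerIntegral_stepFunction, @norm_eq_sqrt_re_inner ℂ,
    @norm_eq_sqrt_re_inner ℂ _ _ _ _ (stepFunction x), inner_stepIntegral]

lemma inner_wienerIntegral_intervalL2 (h₁ : IsTwoSidedBrownian B₁ P)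
    (h₂ : IsTwoSidedBrownian B₂ P) (p q : TimeInterval) :
    inner ℂ (wienerIntegral h₂ (intervalL2 q)) (wienerIntegral h₁ (intervalL2 p))
      = ((∫ ω, (B₁ p.1.2 ω - B₁ p.1.1 ω) * (B₂ q.1.2 ω - B₂ q.1.1 ω) ∂P : ℝ) : ℂ) := by
  rw [← stepFunction_single, ← stepFunction_single, wienerIntegral_stepFunction,
    wienerIntegral_stepFunction, stepIntegral, stepIntegral, Finsupp.linearCombination_single,
    Finsupp.linearCombination_single, one_smul, one_smul, L2.inner_def, ← integral_complex_ofReal]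
  refine integral_congr_ae ?_
  filter_upwards [(((h₁.memLp p.1.2).sub (h₁.memLp p.1.1)).ofReal (K := ℂ)).coeFn_toLp,
    (((h₂.memLp q.1.2).sub (h₂.memLp q.1.1)).ofReal (K := ℂ)).coeFn_toLp] with ω e1 e2
  rw [e1, e2]
  simp

/-- The operator `C` on `L²(ℝ)` with `⟪v, C u⟫ = E[(∫ u dB¹) conj(∫ v dB²)]`. -/
noncomputable def crossCovariance (h₁ : IsTwoSidedBrownian B₁ P) (h₂ : IsTwoSidedBrownian B₂ P) :
    Lp ℂ 2 (volume : Measure ℝ) →L[ℂ] Lp ℂ 2 (volume : Measure ℝ) :=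
  (wienerIntegral h₂).adjoint ∘L wienerIntegral h₁

lemma inner_crossCovariance (h₁ : IsTwoSidedBrownian B₁ P) (h₂ : IsTwoSidedBrownian B₂ P)
    (u v : Lp ℂ 2 (volume : Measure ℝ)) :
    inner ℂ v (crossCovariance h₁ h₂ u) = inner ℂ (wienerIntegral h₂ v) (wienerIntegral h₁ u) := by
  rw [crossCovariance, ContinuousLinearMap.comp_apply, ContinuousLinearMap.adjoint_inner_right]

lemma norm_crossCovariance_apply_le (h₁ : IsTwoSidedBrownian B₁ P) (h₂ : IsTwoSidedBrownian B₂ P)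
    (u : Lp ℂ 2 (volume : Measure ℝ)) : ‖crossCovariance h₁ h₂ u‖ ≤ ‖u‖ := by
  rw [crossCovariance, ContinuousLinearMap.comp_apply]
  refine ((wienerIntegral h₂).adjoint.le_opNorm (wienerIntegral h₁ u)).trans ?_
  rw [LinearIsometryEquiv.norm_map, norm_wienerIntegral]
  refine mul_le_of_le_one_left (norm_nonneg _) ?_
  exact ContinuousLinearMap.opNorm_le_bound _ zero_le_one fun v => by
    rw [norm_wienerIntegral, one_mul]

/-- A cross-spectral density is the symbol of the cross-covariance operator. -/
lemma isCrossSpectralDensity_of_crossCovariance_eq {h₁ : IsTwoSidedBrownian B₁ P}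
    {h₂ : IsTwoSidedBrownian B₂ P} {f : ℝ → ℂ}
    (hf : MemLp (fun x => f (2 * Real.pi * x)) ∞ volume)
    (h : crossCovariance h₁ h₂ = multiplierL2 _ hf) : IsCrossSpectralDensity h₁ h₂ f := by
  intro u v
  have e1 : ∫ ω, wienerIntegral h₁ u ω * conj (wienerIntegral h₂ v ω) ∂P
      = inner ℂ v (crossCovariance h₁ h₂ u) := by
    rw [inner_crossCovariance, L2.inner_def]
    rfl
  rw [e1, h, inner_multiplierL2, inner_mulL2]
  have hpi : 2 * Real.pi ≠ 0 := by positivity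
  -- Substitution `lam = 2πx`; its Jacobian cancels the factor `1 / (2π)`.
  have := Measure.integral_comp_div (fun x => 𝓕 u x * conj (𝓕 v x) * f (2 * Real.pi * x))
    (2 * Real.pi)
  simp only [mul_div_cancel₀ _ hpi] at this
  simp only [fourierL2]
  rw [this, abs_of_pos (by positivity), Complex.real_smul, ← mul_assoc]
  push_cast
  rw [one_div_mul_cancel (by exact_mod_cast hpi), one_mul]

end Wiener

/-! ### Operators commuting with modulations are multiplications -/

/-- Serves as a nowhere vanishing element of `L²(ℝ)` by which one may divide. -/
lemma memLp_gaussian : MemLp (fun x : ℝ => (Real.exp (-x ^ 2) : ℂ)) 2 volume := by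
  refine (memLp_two_iff_integrable_sq_norm (Continuous.aestronglyMeasurable (by fun_prop))).2 ?_
  refine (integrable_exp_neg_mul_sq (b := 2) (by norm_num)).congr (.of_forall fun x => ?_)
  simp only
  rw [Complex.norm_real, Real.norm_of_nonneg (Real.exp_pos _).le, ← Real.exp_nat_mul]
  congr 1
  push_cast
  ring

/-- If `A` commutes with modulations, then `conj (A† w) g = conj w (A g)` pointwise. -/
lemma ae_conj_adjoint_mul_eq {A : Lp ℂ 2 (volume : Measure ℝ) →L[ℂ] Lp ℂ 2 (volume : Measure ℝ)}
    (hA : ∀ h u, A (modulateL2 h u) = modulateL2 h (A u)) (w g : Lp ℂ 2 (volume : Measure ℝ)) :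
    ∀ᵐ x, g x * conj (A.adjoint w x) = A g x * conj (w x) := by
  have i1 : Integrable (fun x => g x * conj (A.adjoint w x)) :=
    L2.integrable_inner (𝕜 := ℂ) (A.adjoint w) g
  have i2 : Integrable (fun x => A g x * conj (w x)) := L2.integrable_inner (𝕜 := ℂ) w (A g)
  -- At `ξ` the transform of the difference is `⟪A† w, M g⟫ - ⟪w, M (A g)⟫`, with `M` the modulation
  -- by `ξ`; it vanishes since `A M = M A`.
  have key := (i1.sub i2).ae_eq_zero_of_fourier_eq_zero fun ξ => ?_
  · filter_upwards [key] with x hx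
    exact sub_eq_zero.1 hx
  have e : ∀ a b : Lp ℂ 2 (volume : Measure ℝ),
      ∫ x, (Real.fourierChar (-(x * ξ)) : ℂ) * (b x * conj (a x)) = inner ℂ a (modulateL2 ξ b) := by
    intro a b
    rw [L2.inner_def]
    refine integral_congr_ae ?_
    filter_upwards [coeFn_modulateL2 ξ b] with x hx
    rw [hx, RCLike.inner_apply, mul_assoc, mul_comm x]
  have b1 : ∀ F : ℝ → ℂ, Integrable F →
      Integrable fun x => (Real.fourierChar (-(x * ξ)) : ℂ) * F x := by
    intro F hF
    refine hF.bdd_mul (c := 1) (Continuous.aestronglyMeasurable (by fun_prop)) (.of_forall fun x => ?_)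
    exact (Circle.norm_coe _).le
  rw [Real.fourier_real_eq]
  simp only [Circle.smul_def, smul_eq_mul, Pi.sub_apply, mul_sub]
  rw [integral_sub (b1 _ i1) (b1 _ i2), e, e, ContinuousLinearMap.adjoint_inner_left, hA, sub_self]

/-- A function `m` such that multiplication by `m` is a contraction of `L²` is bounded by `1`. -/
lemma ae_norm_le_one_of_contraction
    {A : Lp ℂ 2 (volume : Measure ℝ) →L[ℂ] Lp ℂ 2 (volume : Measure ℝ)} (hA : ∀ u, ‖A u‖ ≤ ‖u‖)
    {m : ℝ → ℂ} (hm : Measurable m) (h : ∀ u, A u =ᵐ[volume] fun x => m x * u x) :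
    ∀ᵐ x, ‖m x‖ ≤ 1 := by
  have key : (fun x => ‖m x‖ₑ ^ (2 : ℝ)) ≤ᵐ[volume] fun _ => 1 := by
    refine ae_le_of_forall_setLIntegral_le_of_sigmaFinite (by fun_prop) fun s hs hs' => ?_
    -- Testing the contraction on the indicator of `s` gives `∫ over s of |m|² ≤ volume s`.
    let u : Lp ℂ 2 (volume : Measure ℝ) := indicatorConstLp 2 hs hs'.ne (1 : ℂ)
    have hu : u =ᵐ[volume] s.indicator fun _ => (1 : ℂ) := indicatorConstLp_coeFn
    have e : ∀ v : Lp ℂ 2 (volume : Measure ℝ),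
        ENNReal.ofReal ‖v‖ ^ (2 : ℝ) = ∫⁻ x, ‖v x‖ₑ ^ (2 : ℝ) := by
      intro v
      rw [Lp.norm_def, ENNReal.ofReal_toReal (Lp.eLpNorm_ne_top v)]
      exact eLpNorm_nnreal_pow_eq_lintegral (p := 2) (by norm_num)
    have hle : ENNReal.ofReal ‖A u‖ ^ (2 : ℝ) ≤ ENNReal.ofReal ‖u‖ ^ (2 : ℝ) := by
      gcongr
      exact hA u
    rw [e, e] at hle
    rw [← lintegral_indicator hs, ← lintegral_indicator hs]
    calc _ = ∫⁻ x, ‖A u x‖ₑ ^ (2 : ℝ) := by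
          refine lintegral_congr_ae ?_
          filter_upwards [h u, hu] with x h1 h2
          rw [h1, h2]
          by_cases hx : x ∈ s <;> simp [hx]
      _ ≤ ∫⁻ x, ‖u x‖ₑ ^ (2 : ℝ) := hle
      _ = _ := by
          refine lintegral_congr_ae ?_
          filter_upwards [hu] with x h2
          rw [h2]
          by_cases hx : x ∈ s <;> simp [hx]
  filter_upwards [key] with x hx
  have : ‖m x‖ₑ ^ (2 : ℝ) ≤ 1 ^ (2 : ℝ) := by simpa using hx
  rw [ENNReal.rpow_le_rpow_iff (by norm_num)] at this
  rwa [← ofReal_norm, ENNReal.ofReal_le_one] at this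

/-- A contraction of `L²(ℝ)` commuting with modulations is the multiplication by a function. -/
theorem exists_eq_mulL2 {A : Lp ℂ 2 (volume : Measure ℝ) →L[ℂ] Lp ℂ 2 (volume : Measure ℝ)}
    (hA : ∀ u, ‖A u‖ ≤ ‖u‖) (hmod : ∀ h u, A (modulateL2 h u) = modulateL2 h (A u)) :
    ∃ (m : ℝ → ℂ) (hm : MemLp m ∞ volume), Measurable m ∧ (∀ᵐ x, ‖m x‖ ≤ 1) ∧ A = mulL2 m hm := by
  let φ : Lp ℂ 2 (volume : Measure ℝ) := memLp_gaussian.toLp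
  let m : ℝ → ℂ := fun x => conj (A.adjoint φ x) / (Real.exp (-x ^ 2) : ℂ)
  have hm : Measurable m := by
    refine Measurable.div ?_ (by fun_prop)
    exact Complex.continuous_conj.measurable.comp (Lp.stronglyMeasurable _).measurable
  have hAm : ∀ u, A u =ᵐ[volume] fun x => m x * u x := by
    intro u
    filter_upwards [ae_conj_adjoint_mul_eq hmod φ u, memLp_gaussian.coeFn_toLp] with x h1 h2
    have hne : (Real.exp (-x ^ 2) : ℂ) ≠ 0 := by exact_mod_cast (Real.exp_pos _).ne'
    rw [h2, Complex.conj_ofReal] at h1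
    rw [eq_comm, div_mul_eq_mul_div, div_eq_iff hne, mul_comm, h1]
  have hb := ae_norm_le_one_of_contraction hA hm hAm
  have hm' : MemLp m ∞ volume := memLp_top_of_bound hm.aestronglyMeasurable 1 hb
  refine ⟨m, hm', hm, hb, ContinuousLinearMap.ext fun u => Lp.ext ?_⟩
  filter_upwards [hAm u, coeFn_mulL2 hm' u] with x h1 h2
  rw [h1, h2]

/-- A Fourier multiplier which preserves real functions has a Hermitian symbol. -/
lemma ae_conj_eq_of_conjL2_multiplierL2 {m : ℝ → ℂ} (hm : MemLp m ∞ volume)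
    (h : ∀ u, conjL2 volume (multiplierL2 m hm (conjL2 volume u)) = multiplierL2 m hm u) :
    ∀ᵐ x, conj (m x) = m (-x) := by
  let φ : Lp ℂ 2 (volume : Measure ℝ) := memLp_gaussian.toLp
  have hφ : 𝓕 (𝓕⁻ φ) = φ := (Lp.fourierTransformₗᵢ ℝ ℂ).apply_symm_apply φ
  -- Evaluated at the inverse transform of the Gaussian, the identity becomes one between symbols
  -- times the Gaussian, which is then cancelled.
  have key := congrArg (fun u => (𝓕 u : Lp ℂ 2 (volume : Measure ℝ))) (h (𝓕⁻ φ))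
  simp only [fourier_conjL2, fourier_multiplierL2, hφ] at key
  have hneg := (Measure.measurePreserving_neg (volume : Measure ℝ)).quasiMeasurePreserving
  have hx1 : ∀ᵐ x, conj (m (-x)) * φ x = m x * φ x := by
    filter_upwards [coeFn_mulL2 hm φ, coeFn_conjL2 (reflectL2 (mulL2 m hm (conjL2 volume
      (reflectL2 φ)))), coeFn_reflectL2 (mulL2 m hm (conjL2 volume (reflectL2 φ))),
      hneg.ae (coeFn_mulL2 hm (conjL2 volume (reflectL2 φ))),
      hneg.ae (coeFn_conjL2 (reflectL2 φ)), hneg.ae (coeFn_reflectL2 φ)] with x h1 h2 h3 h4 h5 h6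
    rw [← h1, ← key, h2, h3, h4, h5, h6, neg_neg, map_mul, Complex.conj_conj]
  refine (hneg.ae (hx1.and memLp_gaussian.coeFn_toLp)).mono fun x hx => ?_
  obtain ⟨h1, h2⟩ := hx
  rw [neg_neg] at h1
  refine mul_right_cancel₀ ?_ h1
  rw [h2]
  exact Complex.ofReal_ne_zero.2 (Real.exp_pos _).ne'

lemma quasiMeasurePreserving_const_mul {c : ℝ} (hc : c ≠ 0) :
    Measure.QuasiMeasurePreserving (fun x : ℝ => c * x) volume volume := by
  refine ⟨measurable_const_mul c, ?_⟩
  rw [Real.map_volume_mul_left hc]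
  exact Measure.smul_absolutelyContinuous

/-! ### Existence of the cross-spectral density -/

section Stationary

variable {Ω : Type*} [MeasurableSpace Ω] {B₁ B₂ : ℝ → Ω → ℝ} {P : Measure Ω}

/-- On pairs of intervals this is exactly stationarity of increments; density of step functions
extends it to all of `L²(ℝ)`. -/
lemma inner_translateL2_crossCovariance (hst : HasStationaryIncrements B₁ B₂ P)
    (h₁ : IsTwoSidedBrownian B₁ P) (h₂ : IsTwoSidedBrownian B₂ P) (h : ℝ)
    (u v : Lp ℂ 2 (volume : Measure ℝ)) :
    inner ℂ (translateL2 h v) (crossCovariance h₁ h₂ (translateL2 h u))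
      = inner ℂ v (crossCovariance h₁ h₂ u) := by
  let τ : Lp ℂ 2 (volume : Measure ℝ) →L[ℂ] Lp ℂ 2 (volume : Measure ℝ) :=
    (translateL2 h).toContinuousLinearMap
  have hτ : ∀ u, τ u = translateL2 h u := fun _ => rfl
  have key : τ.adjoint ∘L crossCovariance h₁ h₂ ∘L τ = crossCovariance h₁ h₂ := by
    refine eq_of_inner_intervalL2 fun p q => ?_
    rw [ContinuousLinearMap.comp_apply, ContinuousLinearMap.comp_apply,
      ContinuousLinearMap.adjoint_inner_right, hτ, hτ, translateL2_intervalL2,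
      translateL2_intervalL2, inner_crossCovariance, inner_crossCovariance,
      inner_wienerIntegral_intervalL2, inner_wienerIntegral_intervalL2]
    exact congrArg _ (hst p.1.2 q.1.2 p.1.1 q.1.1 h)
  rw [← hτ, ← hτ, ← ContinuousLinearMap.adjoint_inner_right]
  exact congrArg (fun A => inner ℂ v (A u)) key

/-- Increments are real, so the matrix coefficients of `C` on the real vectors `intervalL2 p` are
real, and these determine `C`. -/
lemma conjL2_crossCovariance (h₁ : IsTwoSidedBrownian B₁ P) (h₂ : IsTwoSidedBrownian B₂ P)
    (u : Lp ℂ 2 (volume : Measure ℝ)) :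
    conjL2 volume (crossCovariance h₁ h₂ (conjL2 volume u)) = crossCovariance h₁ h₂ u := by
  let A : Lp ℂ 2 (volume : Measure ℝ) →L[ℂ] Lp ℂ 2 (volume : Measure ℝ) :=
    { toFun := fun u => conjL2 volume (crossCovariance h₁ h₂ (conjL2 volume u))
      map_add' := fun u v => by simp only [map_add]
      map_smul' := fun c u => by
        rw [conjL2_smul, map_smul, conjL2_smul, Complex.conj_conj, RingHom.id_apply]
      cont := by fun_prop }
  have key : A = crossCovariance h₁ h₂ := by
    refine eq_of_inner_intervalL2 fun p q => ?_
    have e : A (intervalL2 p) = conjL2 volume (crossCovariance h₁ h₂ (conjL2 volume (intervalL2 p))) :=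
      rfl
    rw [e, conjL2_intervalL2]
    conv_lhs => rw [← conjL2_intervalL2 q]
    rw [inner_conjL2, inner_crossCovariance, inner_wienerIntegral_intervalL2, Complex.conj_ofReal]
  exact congrArg (fun A => A u) key

/-- Two-sided Brownian motions with jointly stationary increments have a cross-spectral density. -/
theorem exists_isCrossSpectralDensity (hst : HasStationaryIncrements B₁ B₂ P)
    (h₁ : IsTwoSidedBrownian B₁ P) (h₂ : IsTwoSidedBrownian B₂ P) :
    ∃ f : ℝ → ℂ, Measurable f ∧ eLpNorm f ∞ volume ≤ 1 ∧
      (∀ᵐ lam : ℝ, conj (f lam) = f (-lam)) ∧ IsCrossSpectralDensity h₁ h₂ f := by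
  let F := Lp.fourierTransformₗᵢ ℝ ℂ
  let A : Lp ℂ 2 (volume : Measure ℝ) →L[ℂ] Lp ℂ 2 (volume : Measure ℝ) :=
    (F : Lp ℂ 2 (volume : Measure ℝ) →L[ℂ] Lp ℂ 2 (volume : Measure ℝ)) ∘L crossCovariance h₁ h₂ ∘L
      (F.symm : Lp ℂ 2 (volume : Measure ℝ) →L[ℂ] Lp ℂ 2 (volume : Measure ℝ))
  have hAF : ∀ u, A u = F (crossCovariance h₁ h₂ (F.symm u)) := fun u => rfl
  have hA : ∀ u, ‖A u‖ ≤ ‖u‖ := by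
    intro u
    rw [hAF, F.norm_map, ← F.symm.norm_map u]
    exact norm_crossCovariance_apply_le h₁ h₂ _
  have hF : ∀ h u, F.symm (modulateL2 h u) = translateL2 h (F.symm u) := by
    intro h u
    rw [LinearIsometryEquiv.symm_apply_eq]
    refine Eq.trans ?_ (fourier_translateL2 h (F.symm u)).symm
    exact congrArg _ (F.apply_symm_apply u).symm
  have hmod : ∀ h u, A (modulateL2 h u) = modulateL2 h (A u) := by
    intro h u
    -- Invariance of the form becomes commutation because modulation by `h` is unitary with inverse
    -- modulation by `-h`.
    have hinv : ∀ w, inner ℂ w (A (modulateL2 h u)) = inner ℂ (modulateL2 (-h) w) (A u) := by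
      intro w
      have e : ∀ a b, inner ℂ a (A b) = inner ℂ (F.symm a) (crossCovariance h₁ h₂ (F.symm b)) := by
        intro a b
        rw [hAF, ← F.symm.inner_map_map, F.symm_apply_apply]
      conv_lhs => rw [← modulateL2_neg_modulateL2 h w]
      rw [e, e, hF h, hF h, inner_translateL2_crossCovariance hst]
    refine ext_inner_left ℂ fun w => ?_
    rw [hinv, ← inner_modulateL2 h, modulateL2_neg_modulateL2]
  obtain ⟨m, hm, hmeas, hb, hAm⟩ := exists_eq_mulL2 hA hmod
  have hC : crossCovariance h₁ h₂ = multiplierL2 m hm := by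
    ext1 u
    refine F.injective ?_
    refine Eq.trans ?_ (fourier_multiplierL2 hm u).symm
    rw [← hAm]
    exact congrArg (fun v => F (crossCovariance h₁ h₂ v)) (F.symm_apply_apply u).symm
  have hherm : ∀ᵐ x, conj (m x) = m (-x) := by
    refine ae_conj_eq_of_conjL2_multiplierL2 hm fun u => ?_
    rw [← hC, conjL2_crossCovariance]
  have hpi : (2 * Real.pi)⁻¹ ≠ 0 := by positivity
  have hq := quasiMeasurePreserving_const_mul hpi
  have hfm : (fun x => m ((2 * Real.pi)⁻¹ * (2 * Real.pi * x))) = m := by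
    ext x
    rw [inv_mul_cancel_left₀ (by positivity)]
  refine ⟨fun lam => m ((2 * Real.pi)⁻¹ * lam), by fun_prop, ?_, ?_, ?_⟩
  · rw [eLpNorm_exponent_top]
    simpa using eLpNormEssSup_le_of_ae_bound (hq.ae hb)
  · filter_upwards [hq.ae hherm] with x hx
    rw [hx, mul_neg]
  · refine isCrossSpectralDensity_of_crossCovariance_eq (by rwa [hfm]) ?_
    rw [hC]
    congr
    exact hfm.symm

end Stationary

/-! ### Construction of a pair with a given symbol -/

lemma norm_mulL2_sq_add_norm_mulL2_sq {α : Type*} [MeasurableSpace α] {μ : Measure α}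
    {a b : α → ℂ} (ha : MemLp a ∞ μ) (hb : MemLp b ∞ μ)
    (h : ∀ᵐ x ∂μ, ‖a x‖ ^ 2 + ‖b x‖ ^ 2 = 1) (u : Lp ℂ 2 μ) :
    ‖mulL2 a ha u‖ ^ 2 + ‖mulL2 b hb u‖ ^ 2 = ‖u‖ ^ 2 := by
  rw [← real_inner_self_eq_norm_sq, ← real_inner_self_eq_norm_sq, ← real_inner_self_eq_norm_sq,
    L2.inner_def, L2.inner_def, L2.inner_def,
    ← integral_add (L2.integrable_inner _ _) (L2.integrable_inner _ _)]
  refine integral_congr_ae ?_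
  filter_upwards [coeFn_mulL2 ha u, coeFn_mulL2 hb u, h] with x h1 h2 h3
  rw [h1, h2, real_inner_self_eq_norm_sq, real_inner_self_eq_norm_sq, real_inner_self_eq_norm_sq,
    norm_mul, norm_mul, mul_pow, mul_pow, ← add_mul, h3, one_mul]

lemma real_inner_L2_eq_re {α : Type*} [MeasurableSpace α] {μ : Measure α} (u v : Lp ℂ 2 μ) :
    inner ℝ u v = (inner ℂ u v).re := by
  rw [L2.inner_def, L2.inner_def, ← RCLike.re_eq_complex_re,
    ← integral_re (L2.integrable_inner (𝕜 := ℂ) u v)]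
  rfl

lemma inner_mulL2_conj {α : Type*} [MeasurableSpace α] {μ : Measure α} {m : α → ℂ}
    (hm : MemLp m ∞ μ) (hm' : MemLp (fun x => conj (m x)) ∞ μ) (u v : Lp ℂ 2 μ) :
    inner ℂ u (mulL2 _ hm' v) = inner ℂ (mulL2 m hm u) v := by
  rw [L2.inner_def, L2.inner_def]
  refine integral_congr_ae ?_
  filter_upwards [coeFn_mulL2 hm u, coeFn_mulL2 hm' v] with x h1 h2
  rw [h1, h2, RCLike.inner_apply, RCLike.inner_apply, map_mul]
  ring

/-- Every Hermitian symbol bounded by `1` is the cross-covariance symbol of a pair of jointly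
Gaussian Brownian motions. -/
theorem exists_pair_brownian_of_symbol {m : ℝ → ℂ} (hm : MemLp m ∞ volume)
    (hb : ∀ᵐ x, ‖m x‖ ≤ 1) (hherm : ∀ᵐ x, conj (m x) = m (-x)) :
    ∃ (Ω : Type) (_ : MeasurableSpace Ω) (P : Measure Ω) (_ : IsProbabilityMeasure P)
      (B₁ B₂ : ℝ → Ω → ℝ), IsGaussianProcess (fun t ω => (B₁ t ω, B₂ t ω)) P ∧
        HasStationaryIncrements B₁ B₂ P ∧
        ∃ (h₁ : IsTwoSidedBrownian B₁ P) (h₂ : IsTwoSidedBrownian B₂ P),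
          crossCovariance h₁ h₂ = multiplierL2 m hm := by
  have hmc : MemLp (fun x => conj (m x)) ∞ volume := hm.star
  -- Completes `conj m` to a unit vector `(conj m, g)` at almost every frequency. Where `|m| > 1`, a
  -- null set, the root is 0 by convention.
  let g : ℝ → ℂ := fun x => (√(1 - ‖m x‖ ^ 2) : ℝ)
  have hg : MemLp g ∞ volume := by
    refine memLp_top_of_bound ?_ 1 (.of_forall fun x => ?_)
    · have : Continuous fun z : ℂ => ((√(1 - ‖z‖ ^ 2) : ℝ) : ℂ) := by fun_prop
      exact this.comp_aestronglyMeasurable hm.1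
    · rw [Complex.norm_real, Real.norm_of_nonneg (Real.sqrt_nonneg _)]
      exact Real.sqrt_le_iff.2 ⟨zero_le_one, by nlinarith [sq_nonneg ‖m x‖]⟩
  have hsq : ∀ᵐ x, ‖conj (m x)‖ ^ 2 + ‖g x‖ ^ 2 = 1 := by
    filter_upwards [hb] with x hx
    rw [Complex.norm_real, Real.norm_of_nonneg (Real.sqrt_nonneg _), Real.sq_sqrt, RCLike.norm_conj]
    · ring
    · have := norm_nonneg (m x)
      nlinarith
  let e : ℝ → Lp ℂ 2 (volume : Measure ℝ) := fun t => 𝓕 (signedIntervalL2 t)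
  have he : ∀ s t, ‖e t - e s‖ ^ 2 = |t - s| := by
    intro s t
    rw [← norm_signedIntervalL2_sub_sq, ← Lp.norm_fourier_eq (signedIntervalL2 t - signedIntervalL2 s)]
    exact congrArg (‖·‖ ^ 2) ((Lp.fourierTransformₗᵢ ℝ ℂ).map_sub _ _).symm
  have he0 : e 0 = 0 := by
    simp only [e, signedIntervalL2_zero]
    exact (Lp.fourierTransformₗᵢ ℝ ℂ).map_zero
  -- The second curve uses `conj m` so that moving it across the inner product puts `m` on the
  -- argument of the first curve.
  let φ : Fin 2 → ℝ → WithLp 2 (Lp ℂ 2 (volume : Measure ℝ) × Lp ℂ 2 (volume : Measure ℝ)) :=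
    ![fun t => WithLp.toLp 2 (e t, 0), fun t => WithLp.toLp 2 (mulL2 _ hmc (e t), mulL2 g hg (e t))]
  obtain ⟨Ω, _, P, _, B, hG, hB, hcov⟩ := exists_pair_brownian φ
    (fun i => by fin_cases i <;> simp [φ, he0])
    (fun i s t => by
      fin_cases i
      · simpa [φ, WithLp.prod_norm_sq_eq_of_L2] using he s t
      · simp only [φ, WithLp.prod_norm_sq_eq_of_L2]
        simpa [← map_sub] using (norm_mulL2_sq_add_norm_mulL2_sq hmc hg hsq (e t - e s)).trans
          (he s t))
  have hcov' : ∀ s t, ∫ ω, B 0 s ω * B 1 t ω ∂P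
      = (inner ℂ (signedIntervalL2 t) (multiplierL2 m hm (signedIntervalL2 s))).re := by
    intro s t
    rw [hcov, inner_multiplierL2]
    have : inner ℝ (φ 0 s) (φ 1 t) = inner ℝ (e s) (mulL2 _ hmc (e t)) := by
      simp [φ, WithLp.prod_inner_apply]
    rw [this, real_inner_L2_eq_re, inner_mulL2_conj hm hmc, ← inner_conj_symm, Complex.conj_re]
  have hint : ∀ s t, Integrable (fun ω => B 0 s ω * B 1 t ω) P := fun s t =>
    ((hB 0).memLp s).integrable_mul ((hB 1).memLp t)
  have hint' : ∀ a b c d, Integrable (fun ω => B 0 a ω * B 1 b ω - B 0 c ω * B 1 d ω) P :=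
    fun a b c d => (hint a b).sub (hint c d)
  have hincr : ∀ s₁ t₁ s₂ t₂, ∫ ω, (B 0 t₁ ω - B 0 s₁ ω) * (B 1 t₂ ω - B 1 s₂ ω) ∂P
      = (inner ℂ (signedIntervalL2 t₂ - signedIntervalL2 s₂)
        (multiplierL2 m hm (signedIntervalL2 t₁ - signedIntervalL2 s₁))).re := by
    intro s₁ t₁ s₂ t₂
    simp only [map_sub, inner_sub_left, inner_sub_right, Complex.sub_re, ← hcov']
    rw [← integral_sub (hint _ _) (hint _ _), ← integral_sub (hint _ _) (hint _ _),
      ← integral_sub (hint' _ _ _ _) (hint' _ _ _ _)]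
    refine integral_congr_ae (.of_forall fun ω => ?_)
    simp only
    ring
  have htr : ∀ h s t, signedIntervalL2 (t + h) - signedIntervalL2 (s + h)
      = translateL2 h (signedIntervalL2 t - signedIntervalL2 s) := by
    intro h s t
    wlog hst : s ≤ t generalizing s t
    · rw [← neg_sub, this t s (le_of_not_ge hst), ← map_neg, neg_sub]
    rw [signedIntervalL2_sub ⟨(s, t), hst⟩, translateL2_intervalL2, ← signedIntervalL2_sub]
    rfl
  refine ⟨Ω, _, P, inferInstance, B 0, B 1, hG, fun t₁ t₂ s₁ s₂ h => ?_, hB 0, hB 1, ?_⟩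
  · rw [hincr, hincr, htr, htr, inner_translateL2_multiplierL2]
  · refine eq_of_inner_intervalL2 fun p q => ?_
    rw [inner_crossCovariance, inner_wienerIntegral_intervalL2, hincr, signedIntervalL2_sub,
      signedIntervalL2_sub]
    -- The covariances supply only the real part of the matrix coefficient; by Hermitian symmetry it
    -- equals its own conjugate, so the coefficient is real.
    refine Complex.conj_eq_iff_re.1 ?_
    rw [← inner_conjL2_multiplierL2 hm hherm, conjL2_intervalL2, conjL2_intervalL2]

theorem proposition2 :
    (∀ f : ℝ → ℂ, AEMeasurable f volume → eLpNorm f ∞ volume ≤ 1 →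
      (∀ᵐ lam : ℝ, conj (f lam) = f (-lam)) →
      ∃ (Ω : Type) (_ : MeasurableSpace Ω) (P : Measure Ω) (_ : IsProbabilityMeasure P)
        (B₁ B₂ : ℝ → Ω → ℝ),
        IsGaussianProcess (fun t ω => (B₁ t ω, B₂ t ω)) P ∧
        HasStationaryIncrements B₁ B₂ P ∧
        ∃ (h₁ : IsTwoSidedBrownian B₁ P) (h₂ : IsTwoSidedBrownian B₂ P),
          IsCrossSpectralDensity h₁ h₂ f) ∧
    (∀ (Ω : Type*) [MeasurableSpace Ω] (P : Measure Ω) [IsProbabilityMeasure P]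
      (B₁ B₂ : ℝ → Ω → ℝ), HasStationaryIncrements B₁ B₂ P →
      ∀ (h₁ : IsTwoSidedBrownian B₁ P) (h₂ : IsTwoSidedBrownian B₂ P),
        ∃ f : ℝ → ℂ, Measurable f ∧ eLpNorm f ∞ volume ≤ 1 ∧
          (∀ᵐ lam : ℝ, conj (f lam) = f (-lam)) ∧
          IsCrossSpectralDensity h₁ h₂ f) := by
  refine ⟨fun f hf hf1 hherm => ?_, fun Ω _ P _ B₁ B₂ hst h₁ h₂ =>
    exists_isCrossSpectralDensity hst h₁ h₂⟩
  -- Null sets pull back to null sets under `x ↦ 2πx`, so the almost-everywhere conditions pass to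
  -- the rescaled symbol.
  have hq := quasiMeasurePreserving_const_mul (c := 2 * Real.pi) (by positivity)
  have hfb : ∀ᵐ x, ‖f x‖ ≤ 1 := by
    filter_upwards [ae_le_eLpNormEssSup (f := f) (μ := volume)] with x hx
    rw [eLpNorm_exponent_top] at hf1
    have := hx.trans hf1
    rwa [← ofReal_norm, ENNReal.ofReal_le_one] at this
  have hb : ∀ᵐ x, ‖f (2 * Real.pi * x)‖ ≤ 1 := hq.ae hfb
  have hm : MemLp (fun x => f (2 * Real.pi * x)) ∞ volume :=
    memLp_top_of_bound (hf.aestronglyMeasurable.comp_quasiMeasurePreserving hq) 1 hb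
  have hh : ∀ᵐ x, conj (f (2 * Real.pi * x)) = f (2 * Real.pi * -x) := by
    filter_upwards [hq.ae hherm] with x hx
    rw [hx, mul_neg]
  obtain ⟨Ω, _, P, _, B₁, B₂, hG, hst, h₁, h₂, h⟩ := exists_pair_brownian_of_symbol hm hb hh
  exact ⟨Ω, _, P, inferInstance, B₁, B₂, hG, hst, h₁, h₂,
    isCrossSpectralDensity_of_crossCovariance_eq hm h⟩
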